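/- Let $\mathcal H$ be a real Hilbert space and $\mathcal L$ a (generally unbounded) self-adjoint positive definite operator on $\mathcal H$: $(\mathcal L v,v)_{\mathcal H}\ge c\|v\|_{\mathcal H}^2$ on its domain for some $c>0$. For $s\ge 0$ let $V^s=D(\mathcal L^{s/2})$ with norm $\|v\|_{V^s}=\|\mathcal L^{s/2}v\|_{\mathcal H}$, and let $V^{-s}$ be the dual of $V^s$ induced by the inner product of $\mathcal H$. Let $\beta,\gamma\ge 0$ with $\beta+\gamma\le 1$, and let $F:V^\gamma\to V^{-\beta}$ satisfy $\|F(v)-F(w)\|_{V^{-\beta}}\le C_L\|v-w\|_{V^\gamma}$ for all $v,w\in V^\gamma$. Let $\epsilon>0$, $T>0$, $A\ge 0$, let $k\ge 1$ be an integer, and let $p(k)$ be a real number with $2p(k)\ge\beta+\gamma$ (for instance $p(k)=(\beta+\gamma)k/2$). Put $\lambda=1-\beta$. Let $u$ be a (weak) solution on $[0,T]$ of $$\frac{du}{dt}+\epsilon\mathcal L u=F(u),$$ such that $F(u)\in H^k(0,T;V^{-\beta})$ and $u\in H^1(0,T;V^{2p(k)-\beta})$. For time nodes $0=t_0<t_1<\dots<t_N$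 let $\tau_n=t_{n+1}-t_n$ and $\tau=\max_n\tau_n$. Given starting values $u^0,\dots,u^{k-1}$, the variable-step ETD-MS scheme determines $u^{n+1}=u^{n+1}(t_{n+1})$ for $n\ge k-1$, where $u^{n+1}(\cdot)$ is the (weak) solution of $$\frac{du^{n+1}(t)}{dt}+\epsilon\mathcal L u^{n+1}(t)+A\tau^k\frac{d}{dt}\mathcal L^{p(k)}u^{n+1}(t)=\sum_{i=0}^{k-1}\ell_i(t-t_n)F(u^{n-i}),\quad t\in[t_n,t_{n+1}],\qquad u^{n+1}(t_n)=u^n,$$ $$\ell_i(s)=\prod_{0\le m\le k-1,\ m\ne i}\frac{\sum_{j=1}^m\tau_{n-j}+s}{\sum_{j=1}^m\tau_{n-j}-\sum_{j=1}^i\tau_{n-j}}.$$ Let $e^n=u(t_n)-u^n$. Then for all constants $C_0$ and $r$ there is a constant $C>0$, which may depend on all the data above (including $u$, $T$, $\epsilon$, $A$, $k$), on $C_0$ and on $r$, but not on the time nodes, on $\tau$ or on the numerical solution, such that the following holds. If $\tau<1$, if $\tau_n/\tau_m\le r$ whenever $|n-m|<k$, and if $$\|e^j\|_{V^\lambda}^2+A\tau^k\|e^j\|_{V^{p(k)+\lambda}}^2\le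 C_0\tau^{2k}\qquad\text{for } j=0,\dots,k-1\ \text{ with } j\le N,\ t_j\le T,$$ then $$\|e^n\|_{V^\lambda}^2+A\tau^k\|e^n\|_{V^{p(k)+\lambda}}^2\le C\tau^{2k}\qquad\text{for all } n\le N \text{ with } t_n\le T .$$ Here $\|\cdot\|_{V^s}=\infty$ outside $V^s$, with $0\cdot\infty=0$; the estimate thus includes $e^n\in V^\lambda$ and, if $A>0$, $e^n\in V^{p(k)+\lambda}$. -/

import Mathlib

open MeasureTheory Set
open scoped ENNReal

/-! ### Positive definite self-adjoint operators and their real powers -/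

/-- A positive definite self-adjoint (in general unbounded) operator on a real Hilbert space:
`L = L†` and `(L x, x) ≥ c ‖x‖²` on the domain of `L`, for some `c > 0`.
(Self-adjointness forces the domain to be dense: `IsSelfAdjoint.dense_domain`.) -/
structure PosDefOp (H : Type*) [NormedAddCommGroup H] [InnerProductSpace ℝ H]
    [CompleteSpace H] where
  op : H →ₗ.[ℝ] H
  selfAdjoint : IsSelfAdjoint op
  coercive : ∃ c : ℝ, 0 < c ∧ ∀ x : op.domain, c * ‖(x : H)‖ ^ 2 ≤ inner ℝ (op x) (x : H)

namespace PosDefOp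

variable {H : Type*} [NormedAddCommGroup H] [InnerProductSpace ℝ H] [CompleteSpace H]
  (L : PosDefOp H)

theorem symm (x y : L.op.domain) : inner ℝ (L.op x) (y : H) = inner ℝ (x : H) (L.op y) := by
  have h := LinearPMap.adjoint_isFormalAdjoint (T := L.op) L.selfAdjoint.dense_domain
  rw [LinearPMap.isSelfAdjoint_def.1 L.selfAdjoint] at h
  exact h x y

theorem exists_norm_le :
    ∃ c : ℝ, 0 < c ∧ ∀ x : L.op.domain, c * ‖(x : H)‖ ≤ ‖L.op x‖ := by
  obtain ⟨c, hc, h⟩ := L.coercive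
  refine ⟨c, hc, fun x => ?_⟩
  rcases eq_or_lt_of_le (norm_nonneg (x : H)) with h0 | h0
  · rw [← h0]; simp
  · have h1 := (h x).trans (real_inner_le_norm _ _)
    nlinarith

theorem op_surjective (y : H) : ∃ x : L.op.domain, L.op x = y := by
  obtain ⟨c, hc, hle⟩ := L.exists_norm_le
  have hd := L.selfAdjoint.dense_domain
  have hadj := LinearPMap.isSelfAdjoint_def.1 L.selfAdjoint
  set R : Submodule ℝ H := LinearMap.range L.op.toFun with hR
  have hmem : ∀ z, z ∈ R ↔ ∃ x : L.op.domain, L.op x = z := fun z => Iff.rfl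
  have hclosed : IsClosed (R : Set H) := by
    refine isClosed_of_closure_subset fun z hz => ?_
    obtain ⟨w, hw, hlim⟩ := mem_closure_iff_seq_limit.1 hz
    choose x hx using hw
    have hcx : CauchySeq fun n => (x n : H) := by
      have hcw := hlim.cauchySeq
      rw [Metric.cauchySeq_iff] at hcw ⊢
      intro ε hε
      obtain ⟨N, hN⟩ := hcw (c * ε) (by positivity)
      refine ⟨N, fun m hm n hn => ?_⟩
      have h1 := hN m hm n hn
      have h2 := hle (x m - x n)
      rw [LinearPMap.map_sub] at h2
      have h3 : L.op (x m) - L.op (x n) = w m - w n := by rw [← hx m, ← hx n]; rfl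
      rw [h3] at h2
      rw [dist_eq_norm] at h1 ⊢
      have h4 : c * ‖((x m - x n : L.op.domain) : H)‖ < c * ε := lt_of_le_of_lt h2 h1
      exact lt_of_mul_lt_mul_left h4 hc.le
    obtain ⟨a, ha⟩ := cauchySeq_tendsto_of_complete hcx
    have hcl : IsClosed (L.op.graph : Set (H × H)) := L.selfAdjoint.isClosed
    have hg : (a, z) ∈ (L.op.graph : Set (H × H)) := by
      refine hcl.mem_of_tendsto (ha.prodMk_nhds hlim) (Filter.Eventually.of_forall fun n => ?_)
      have := L.op.mem_graph (x n)
      have h3 : L.op (x n) = w n := hx n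
      rwa [h3] at this
    rw [SetLike.mem_coe, LinearPMap.mem_graph_iff] at hg
    obtain ⟨b, -, hb⟩ := hg
    exact (hmem z).2 ⟨b, hb⟩
  have hperp : Rᗮ = ⊥ := by
    rw [eq_bot_iff]
    intro v hv
    have hv' : ∀ x : L.op.domain, inner ℝ (0 : H) (x : H) = inner ℝ v (L.op x) := by
      intro x
      have h1 : inner ℝ (L.op x) v = 0 := hv _ ((hmem _).2 ⟨x, rfl⟩)
      rw [inner_zero_left, real_inner_comm, h1]
    have hvd : v ∈ (L.op).adjoint.domain := L.op.mem_adjoint_domain_of_exists v ⟨0, hv'⟩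
    rw [hadj] at hvd
    have h0 : L.op ⟨v, hvd⟩ = 0 := by
      have hz : ∀ x : L.op.domain, inner ℝ (L.op ⟨v, hvd⟩) (x : H) = inner ℝ (0 : H) (x : H) := by
        intro x
        rw [hv' x]
        exact L.symm ⟨v, hvd⟩ x
      exact hd.eq_of_inner_left ℝ fun z hzmem => hz ⟨z, hzmem⟩
    have h2 := hle ⟨v, hvd⟩
    rw [h0, norm_zero] at h2
    have h3 : ‖v‖ ≤ 0 := by
      by_contra hcon
      push Not at hcon
      have : 0 < c * ‖v‖ := mul_pos hc hcon
      exact absurd h2 (not_le.2 this)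
    simpa using h3
  have htop : R = ⊤ := by
    have hcomp : CompleteSpace R := hclosed.completeSpace_coe
    exact Submodule.orthogonal_eq_bot_iff.1 hperp
  exact (hmem y).1 (htop ▸ Submodule.mem_top)

theorem exists_inv : ∃ K : H →L[ℝ] H, ∀ y, ∃ h : K y ∈ L.op.domain, L.op ⟨K y, h⟩ = y := by
  obtain ⟨c, hc, hle⟩ := L.exists_norm_le
  have hinj : ∀ a b : L.op.domain, L.op a = L.op b → a = b := by
    intro a b hab
    have h := hle (a - b)
    rw [LinearPMap.map_sub, hab, sub_self, norm_zero] at h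
    have h1 : ‖((a - b : L.op.domain) : H)‖ ≤ 0 := by
      by_contra hcon
      push Not at hcon
      exact absurd h (not_le.2 (mul_pos hc hcon))
    have h2 : ((a - b : L.op.domain) : H) = 0 := by simpa using h1
    exact sub_eq_zero.1 (Subtype.ext h2)
  choose g hg using L.op_surjective
  let K₀ : H →ₗ[ℝ] H :=
    { toFun := fun y => (g y : H)
      map_add' := fun a b => by
        have : g (a + b) = g a + g b := hinj _ _ (by rw [LinearPMap.map_add, hg, hg, hg])
        rw [this]; rfl
      map_smul' := fun r a => by
        have : g (r • a) = r • g a := hinj _ _ (by rw [LinearPMap.map_smul, hg, hg])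
        rw [this]; rfl }
  refine ⟨K₀.mkContinuous c⁻¹ fun y => ?_, fun y => ⟨(g y).2, hg y⟩⟩
  have := hle (g y)
  rw [hg] at this
  rw [inv_mul_eq_div, le_div_iff₀ hc, mul_comm]
  exact this

/-- The bounded inverse `L⁻¹ : H → H`. -/
noncomputable def inv : H →L[ℝ] H := L.exists_inv.choose

theorem inv_mem (y : H) : L.inv y ∈ L.op.domain := (L.exists_inv.choose_spec y).1

theorem op_inv (y : H) : L.op ⟨L.inv y, L.inv_mem y⟩ = y := (L.exists_inv.choose_spec y).2

theorem inv_injective : Function.Injective L.inv := by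
  intro a b hab
  rw [← L.op_inv a, ← L.op_inv b]
  congr 2

theorem inv_op (x : L.op.domain) : L.inv (L.op x) = x := by
  obtain ⟨c, hc, hle⟩ := L.exists_norm_le
  have h := hle (⟨L.inv (L.op x), L.inv_mem _⟩ - x)
  rw [LinearPMap.map_sub, L.op_inv, sub_self, norm_zero] at h
  have h1 : ‖L.inv (L.op x) - x‖ ≤ 0 := by
    by_contra hcon
    push Not at hcon
    exact absurd h (not_le.2 (mul_pos hc hcon))
  exact sub_eq_zero.1 (by simpa using h1)

theorem inv_symm (x y : H) : inner ℝ (L.inv x) y = inner ℝ x (L.inv y) := by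
  have h := L.symm ⟨L.inv x, L.inv_mem x⟩ ⟨L.inv y, L.inv_mem y⟩
  rw [L.op_inv, L.op_inv] at h
  exact h.symm

theorem inv_nonneg (x : H) : 0 ≤ inner ℝ (L.inv x) x := by
  obtain ⟨c, hc, h⟩ := L.coercive
  have := h ⟨L.inv x, L.inv_mem x⟩
  rw [L.op_inv, real_inner_comm] at this
  exact le_trans (by positivity) this

/-- `L⁻¹ / ‖L⁻¹‖ - 1`, an operator of norm at most one. -/
noncomputable def shift : H →L[ℝ] H := ‖L.inv‖⁻¹ • L.inv - 1

theorem norm_shift_le : ‖L.shift‖ ≤ 1 := by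
  refine ContinuousLinearMap.opNorm_le_bound _ zero_le_one fun x => ?_
  rw [one_mul]
  rcases eq_or_lt_of_le (norm_nonneg L.inv) with hM | hM
  · simp [shift, ← hM]
  · set M := ‖L.inv‖
    set K := L.inv
    have hsh : L.shift x = M⁻¹ • K x - x := rfl
    have h1 := L.inv_nonneg (x - M⁻¹ • K x)
    have h2 : inner ℝ (K (K x)) (K x) ≤ M * ‖K x‖ ^ 2 := by
      refine (real_inner_le_norm _ _).trans ?_
      have := K.le_opNorm (K x)
      nlinarith [norm_nonneg (K x)]
    have h3 : inner ℝ (K (K x)) x = ‖K x‖ ^ 2 := by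
      rw [L.inv_symm, real_inner_self_eq_norm_sq]
    have h4 : inner ℝ (K (x - M⁻¹ • K x)) (x - M⁻¹ • K x)
        = inner ℝ (K x) x - 2 * M⁻¹ * ‖K x‖ ^ 2 + M⁻¹ ^ 2 * inner ℝ (K (K x)) (K x) := by
      rw [map_sub, map_smul, inner_sub_left, inner_sub_right, inner_sub_right,
        real_inner_smul_left, real_inner_smul_right, real_inner_smul_right, real_inner_smul_left,
        h3, real_inner_self_eq_norm_sq]
      ring
    change 0 ≤ inner ℝ (K (x - M⁻¹ • K x)) (x - M⁻¹ • K x) at h1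
    rw [h4] at h1
    have h5 : M⁻¹ ^ 2 * inner ℝ (K (K x)) (K x) ≤ M⁻¹ * ‖K x‖ ^ 2 := by
      calc M⁻¹ ^ 2 * inner ℝ (K (K x)) (K x) ≤ M⁻¹ ^ 2 * (M * ‖K x‖ ^ 2) := by gcongr
        _ = M⁻¹ * ‖K x‖ ^ 2 := by field_simp
    have h6 : M⁻¹ * ‖K x‖ ^ 2 ≤ inner ℝ (K x) x := by nlinarith
    have h7 : ‖L.shift x‖ ^ 2 ≤ ‖x‖ ^ 2 := by
      rw [hsh, norm_sub_sq_real, norm_smul, real_inner_smul_left, mul_pow, Real.norm_eq_abs,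
        sq_abs]
      have : M⁻¹ ^ 2 * ‖K x‖ ^ 2 ≤ M⁻¹ * inner ℝ (K x) x := by
        calc M⁻¹ ^ 2 * ‖K x‖ ^ 2 = M⁻¹ * (M⁻¹ * ‖K x‖ ^ 2) := by ring
          _ ≤ _ := by gcongr
      have h8 : 0 ≤ M⁻¹ * inner ℝ (K x) x :=
        mul_nonneg (by positivity) (L.inv_nonneg x)
      nlinarith
    exact le_of_sq_le_sq h7 (norm_nonneg _)

theorem choose_succ_mul (s : ℝ) (j : ℕ) :
    ((j : ℝ) + 1) * Ring.choose s (j + 1) = (s - j) * Ring.choose s j := by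
  rw [Ring.choose_eq_smul, Ring.choose_eq_smul, descPochhammer_succ_right, Polynomial.smeval_mul,
    Polynomial.smeval_sub, Polynomial.smeval_X, Polynomial.smeval_natCast, Nat.factorial_succ]
  have : (j.factorial : ℝ) ≠ 0 := by positivity
  have h2 : (j : ℝ) + 1 ≠ 0 := by positivity
  push_cast
  simp only [smul_eq_mul, pow_one, pow_zero, nsmul_eq_mul, mul_one]
  field_simp

/-- The binomial coefficients `(s choose j)` are absolutely summable in `j` for `s ≥ 0`. -/
theorem summable_choose {s : ℝ} (hs : 0 ≤ s) : Summable fun j : ℕ => |Ring.choose s j| := by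
  rcases eq_or_lt_of_le hs with rfl | hs
  · refine summable_of_ne_finset_zero (s := {0}) fun j hj => ?_
    rw [Ring.choose_zero_pos ℝ (Nat.pos_of_ne_zero (by simpa using hj)), abs_zero]
  obtain ⟨N, hN⟩ := exists_nat_ge s
  rw [← summable_nat_add_iff N]
  set b : ℕ → ℝ := fun j => (j : ℝ) * |Ring.choose s j| with hb
  have hstep : ∀ i, s * |Ring.choose s (i + N)| = b (i + N) - b (i + 1 + N) := by
    intro i
    have h := choose_succ_mul s (i + N)
    have h1 : ((i + N : ℕ) : ℝ) + 1 > 0 := by positivity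
    have h2 : s - ((i + N : ℕ) : ℝ) ≤ 0 := by
      push_cast
      have : (0 : ℝ) ≤ i := by positivity
      linarith
    have h3 := congrArg abs h
    rw [abs_mul, abs_mul, abs_of_pos h1, abs_of_nonpos h2] at h3
    have h4 : b (i + 1 + N) = (((i + N : ℕ) : ℝ) + 1) * |Ring.choose s (i + N + 1)| := by
      simp only [hb]
      rw [show i + 1 + N = i + N + 1 by ring]
      push_cast
      ring
    rw [h4, h3]
    simp only [hb]
    ring
  refine summable_of_sum_range_le (c := b N / s) (fun _ => abs_nonneg _) fun n => ?_
  rw [le_div_iff₀ hs, Finset.sum_mul]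
  calc ∑ i ∈ Finset.range n, |Ring.choose s (i + N)| * s
      = ∑ i ∈ Finset.range n, (b (i + N) - b (i + 1 + N)) :=
        Finset.sum_congr rfl fun i _ => by rw [mul_comm, hstep]
    _ = b (0 + N) - b (n + N) := Finset.sum_range_sub' (fun i => b (i + N)) n
    _ ≤ b N := by
        rw [zero_add]
        have : 0 ≤ b (n + N) := by positivity
        linarith

theorem norm_shift_pow_le (j : ℕ) : ‖L.shift ^ j‖ ≤ 1 := by
  rcases subsingleton_or_nontrivial H with h | h
  · rw [Subsingleton.elim (L.shift ^ j) 0]; simp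
  · exact (norm_pow_le _ _).trans (pow_le_one₀ (norm_nonneg _) L.norm_shift_le)

theorem summable_series {s : ℝ} (hs : 0 ≤ s) :
    Summable fun j : ℕ => ‖Ring.choose s j • L.shift ^ j‖ := by
  refine Summable.of_nonneg_of_le (fun _ => norm_nonneg _) (fun j => ?_) (summable_choose hs)
  rw [norm_smul, Real.norm_eq_abs]
  exact mul_le_of_le_one_right (abs_nonneg _) (L.norm_shift_pow_le j)

/-- The bounded operator `L^{-s}`, `s ≥ 0`, through the (absolutely convergent) binomial series
`K^s = ‖K‖^s ∑_j (s choose j) (K / ‖K‖ - 1)^j` for the nonnegative self-adjoint operator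
`K = L⁻¹`. -/
noncomputable def invPow (s : ℝ) : H →L[ℝ] H :=
  ‖L.inv‖ ^ s • ∑' j : ℕ, Ring.choose s j • L.shift ^ j

theorem invPow_zero : L.invPow 0 = 1 := by
  rw [invPow, tsum_eq_single 0]
  · simp
  · intro j hj
    rw [Ring.choose_zero_pos ℝ (Nat.pos_of_ne_zero hj), zero_smul]

theorem norm_inv_pos [Nontrivial H] : 0 < ‖L.inv‖ := by
  rw [norm_pos_iff]
  intro h
  obtain ⟨x, hx⟩ := exists_ne (0 : H)
  exact hx (L.inv_injective (by rw [h]; simp))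

theorem invPow_one : L.invPow 1 = L.inv := by
  rcases subsingleton_or_nontrivial H with h | h
  · ext x; exact Subsingleton.elim _ _
  have hM := L.norm_inv_pos
  rw [invPow, tsum_eq_sum (s := Finset.range 2)]
  · have h1 : Ring.choose (1 : ℝ) 1 = 1 := by rw [Ring.choose_one_right]
    simp [Finset.sum_range_succ, h1, shift, smul_smul, hM.ne']
  · intro j hj
    have h2 : Ring.choose (1 : ℝ) j = 0 := by
      have := Ring.choose_natCast (R := ℝ) 1 j
      rw [Nat.cast_one] at this
      rw [this, Nat.choose_eq_zero_of_lt (by simpa using hj), Nat.cast_zero]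
    rw [h2, zero_smul]

theorem invPow_add {s r : ℝ} (hs : 0 ≤ s) (hr : 0 ≤ r) :
    L.invPow (s + r) = L.invPow s * L.invPow r := by
  rcases subsingleton_or_nontrivial H with h | h
  · ext x; exact Subsingleton.elim _ _
  have hM := L.norm_inv_pos
  rw [invPow, invPow, invPow, smul_mul_smul_comm, ← Real.rpow_add hM,
    tsum_mul_tsum_eq_tsum_sum_antidiagonal_of_summable_norm (L.summable_series hs)
      (L.summable_series hr)]
  congr 2
  ext1 j
  rw [Ring.add_choose_eq j (Commute.all s r), Finset.sum_smul]
  refine Finset.sum_congr rfl fun ij hij => ?_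
  rw [smul_mul_smul_comm, ← pow_add, Finset.HasAntidiagonal.mem_antidiagonal.1 hij]

theorem invPow_symm {s : ℝ} (hs : 0 ≤ s) (x y : H) :
    inner ℝ (L.invPow s x) y = inner ℝ x (L.invPow s y) := by
  have hsh : ∀ a b : H, inner ℝ (L.shift a) b = inner ℝ a (L.shift b) := by
    intro a b
    simp [shift, inner_sub_left, inner_sub_right, real_inner_smul_left, real_inner_smul_right,
      L.inv_symm]
  have hpow : ∀ (j : ℕ) (a b : H), inner ℝ ((L.shift ^ j) a) b = inner ℝ a ((L.shift ^ j) b) := by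
    intro j
    induction j with
    | zero => intro a b; simp
    | succ j ih =>
      intro a b
      rw [pow_succ, mul_apply_eq_comp, ih, hsh, ← mul_apply_eq_comp,
        ← pow_succ', pow_succ]
  have hsum := (L.summable_series hs).of_norm
  have happ : ∀ z : H, HasSum (fun j : ℕ => Ring.choose s j • (L.shift ^ j) z)
      ((∑' j : ℕ, Ring.choose s j • L.shift ^ j) z) := fun z =>
    hsum.hasSum.mapL (ContinuousLinearMap.apply ℝ H z)
  have hx := (happ x).mapL (innerSL ℝ y)
  have hy := (happ y).mapL (innerSL ℝ x)
  have hxy : inner ℝ y ((∑' j : ℕ, Ring.choose s j • L.shift ^ j) x)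
      = inner ℝ x ((∑' j : ℕ, Ring.choose s j • L.shift ^ j) y) := by
    refine hx.unique ?_
    simp only [innerSL_apply_apply, real_inner_smul_right] at hy ⊢
    refine hy.congr_fun fun j => ?_
    rw [real_inner_comm, hpow]
  simp only [invPow, smul_apply, real_inner_smul_left, real_inner_smul_right]
  rw [real_inner_comm, hxy]

theorem invPow_natCast (n : ℕ) : L.invPow n = L.inv ^ n := by
  induction n with
  | zero => rw [Nat.cast_zero, invPow_zero, pow_zero]
  | succ n ih =>
    rw [Nat.cast_succ, L.invPow_add n.cast_nonneg zero_le_one, ih, invPow_one, pow_succ]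

theorem invPow_injective {s : ℝ} (hs : 0 ≤ s) : Function.Injective (L.invPow s) := by
  obtain ⟨n, hn⟩ := exists_nat_ge s
  have h : L.invPow (n - s) * L.invPow s = L.inv ^ n := by
    rw [← L.invPow_add (by linarith) hs, sub_add_cancel, invPow_natCast]
  have hinj : Function.Injective (L.inv ^ n) := by
    clear h hn
    induction n with
    | zero => exact fun a b hab => hab
    | succ n ih => rw [pow_succ]; exact ih.comp L.inv_injective
  intro a b hab
  apply hinj
  rw [← h, mul_apply_eq_comp, mul_apply_eq_comp, hab]

/-- The power `L^s`, `s ∈ ℝ`: for `s ≥ 0` the (in general unbounded) inverse of the injective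
bounded operator `L^{-s}`, with domain the range of `L^{-s}`; for `s < 0` a bounded operator. -/
noncomputable def pow (s : ℝ) : H →ₗ.[ℝ] H :=
  if 0 ≤ s then ((L.invPow s : H →ₗ[ℝ] H).toPMap ⊤).inverse
  else (L.invPow (-s) : H →ₗ[ℝ] H).toPMap ⊤

theorem ker_toPMap {s : ℝ} (hs : 0 ≤ s) :
    ((L.invPow s : H →ₗ[ℝ] H).toPMap ⊤).toFun.ker = ⊥ := by
  rw [LinearMap.ker_eq_bot]
  intro a b hab
  exact Subtype.ext (L.invPow_injective hs hab)

theorem mem_pow_domain {s : ℝ} (hs : 0 ≤ s) (v : H) :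
    v ∈ (L.pow s).domain ↔ ∃ w, L.invPow s w = v := by
  rw [pow, if_pos hs, LinearPMap.inverse_domain, LinearMap.mem_range]
  constructor
  · rintro ⟨w, hw⟩; exact ⟨w, hw⟩
  · rintro ⟨w, hw⟩; exact ⟨⟨w, Submodule.mem_top⟩, hw⟩

theorem pow_apply_eq {s : ℝ} (hs : 0 ≤ s) (v : (L.pow s).domain) (w : H)
    (hw : L.invPow s w = v) : L.pow s v = w := by
  have key : ∀ (f : H →ₗ.[ℝ] H), f = ((L.invPow s : H →ₗ[ℝ] H).toPMap ⊤).inverse →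
      ∀ v : f.domain, L.invPow s w = v → f v = w := by
    rintro f rfl v hv
    exact LinearPMap.inverse_apply_eq (L.ker_toPMap hs) (x := ⟨w, Submodule.mem_top⟩) hv
  exact key _ (by rw [pow, if_pos hs]) v hw

theorem invPow_pow {s : ℝ} (hs : 0 ≤ s) (v : (L.pow s).domain) :
    L.invPow s (L.pow s v) = v := by
  obtain ⟨w, hw⟩ := (L.mem_pow_domain hs v).1 v.2
  rw [L.pow_apply_eq hs v w hw, hw]

theorem pow_one : L.pow 1 = L.op := by
  refine LinearPMap.ext ?_ ?_
  · ext v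
    rw [L.mem_pow_domain zero_le_one, invPow_one]
    constructor
    · rintro ⟨w, rfl⟩; exact L.inv_mem w
    · intro hv; exact ⟨L.op ⟨v, hv⟩, L.inv_op ⟨v, hv⟩⟩
  · intro v hv hv'
    refine L.pow_apply_eq zero_le_one ⟨v, hv⟩ _ ?_
    rw [invPow_one, L.inv_op ⟨v, hv'⟩]

theorem pow_injective (s : ℝ) : Function.Injective (L.pow s).toFun := by
  rcases le_or_gt 0 s with hs | hs
  · intro a b hab
    have hab' : L.pow s a = L.pow s b := hab
    exact Subtype.ext (by rw [← L.invPow_pow hs a, ← L.invPow_pow hs b, hab'])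
  · have key : ∀ f : H →ₗ.[ℝ] H, f = (L.invPow (-s) : H →ₗ[ℝ] H).toPMap ⊤ →
        Function.Injective f.toFun := by
      rintro f rfl a b hab
      exact Subtype.ext (L.invPow_injective (by linarith) hab)
    exact key _ (by rw [pow, if_neg (not_le.2 hs)])

/-! ### The scale of spaces `V^s` -/

/-- The space `V^s = D(L^{s/2})`, for `s ≥ 0`, normed by `‖v‖_{V^s} = ‖L^{s/2} v‖`. -/
def V (s : ℝ) : Type _ := (L.pow (s / 2)).domain

noncomputable instance (s : ℝ) : AddCommGroup (L.V s) :=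
  inferInstanceAs (AddCommGroup (L.pow (s / 2)).domain)

noncomputable instance (s : ℝ) : Module ℝ (L.V s) :=
  inferInstanceAs (Module ℝ (L.pow (s / 2)).domain)

/-- `L^{s/2}` as a map `V^s → H`. -/
noncomputable def powV (s : ℝ) : L.V s →ₗ[ℝ] H := (L.pow (s / 2)).toFun

noncomputable instance (s : ℝ) : NormedAddCommGroup (L.V s) :=
  NormedAddCommGroup.induced (L.V s) H (L.powV s) (L.pow_injective (s / 2))

noncomputable instance (s : ℝ) : NormedSpace ℝ (L.V s) :=
  NormedSpace.induced ℝ (L.V s) H (L.powV s)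

/-- The inclusion `V^s ⊆ H`. -/
noncomputable def toH {s : ℝ} : L.V s →ₗ[ℝ] H := (L.pow (s / 2)).domain.subtype

/-- For `s ≥ 0` the map `L^{s/2} : V^s → H` is an isometric bijection, so `V^s` is complete. -/
theorem completeSpace_V {s : ℝ} (hs : 0 ≤ s) : CompleteSpace (L.V s) := by
  have hiso : Isometry (L.powV s) := AddMonoidHomClass.isometry_of_norm _ fun _ => rfl
  have hsurj : Function.Surjective (L.powV s) := fun w =>
    ⟨⟨L.invPow (s / 2) w, (L.mem_pow_domain (by linarith) _).2 ⟨w, rfl⟩⟩,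
      L.pow_apply_eq (by linarith) _ w rfl⟩
  rw [hiso.isUniformInducing.completeSpace_congr hsurj]
  infer_instance

/-- The space `V^{-s}`, `s ≥ 0`: the dual of `V^s`, where `h ∈ H` acts by `v ↦ (h, v)_H`. -/
abbrev VDual (s : ℝ) : Type _ := StrongDual ℝ (L.V s)

/-- The `V^s`-norm (`s ≥ 0`) of an arbitrary vector of `H`; it is `∞` off `V^s`. -/
noncomputable def eNormV (s : ℝ) (v : H) : ℝ≥0∞ :=
  open Classical in
  if h : v ∈ (L.pow (s / 2)).domain then ‖L.pow (s / 2) ⟨v, h⟩‖ₑ else ⊤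

/-! ### The evolution equation -/

/-- `u` solves `u' + ε L u = F(u)` on `[0, T]`, tested with `φ ∈ D(L) ∩ V^β`:
`d/dt (u(t), φ)_H + ε (u(t), L φ)_H = ⟨F(u(t)), φ⟩`. -/
def IsSolution (ε T : ℝ) {β γ : ℝ} (F : L.V γ → L.VDual β) (u : ℝ → L.V γ) : Prop :=
  ∀ t ∈ Icc 0 T, ∀ (φ : L.V β) (hφ : L.toH φ ∈ L.op.domain),
    HasDerivWithinAt (fun s => inner ℝ (L.toH (u s)) (L.toH φ))
      (F (u t) φ - ε * inner ℝ (L.toH (u t)) (L.op ⟨L.toH φ, hφ⟩)) (Icc 0 T) t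

end PosDefOp

/-! ### Sobolev spaces `H^k(0, T; X)` -/

/-- `g` is the weak derivative of `f` on `(0, T)`. -/
def IsWeakDeriv {X : Type*} [NormedAddCommGroup X] [NormedSpace ℝ X] (T : ℝ)
    (f g : ℝ → X) : Prop :=
  ∀ φ : ℝ → ℝ, ContDiff ℝ ((⊤ : ℕ∞) : WithTop ℕ∞) φ → HasCompactSupport φ →
    tsupport φ ⊆ Ioo 0 T →
      ∫ t in Ioo 0 T, deriv φ t • f t = -∫ t in Ioo 0 T, φ t • g t

/-- `f ∈ H^k(0, T; X)`: `f` and its weak derivatives up to order `k` are in `L²(0, T; X)`. -/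
def MemSobolev {X : Type*} [NormedAddCommGroup X] [NormedSpace ℝ X] (k : ℕ) (T : ℝ)
    (f : ℝ → X) : Prop :=
  ∃ g : ℕ → ℝ → X, g 0 = f ∧ (∀ j ≤ k, MemLp (g j) 2 (volume.restrict (Ioo 0 T))) ∧
    ∀ j < k, IsWeakDeriv T (g j) (g (j + 1))

/-! ### The variable-step ETD multistep scheme -/

/-- The step size `τ_n = t_{n+1} - t_n`. -/
def stepSize (t : ℕ → ℝ) (n : ℕ) : ℝ := t (n + 1) - t n

/-- The shifted Lagrange basis polynomial `ℓ_i(s)` of the `n`-th step (where `n ≥ k - 1`), with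
`ℓ_i(t_{n-m} - t_n) = 1` if `m = i` and `0` otherwise, for `0 ≤ m ≤ k - 1`. -/
noncomputable def lagrangeBasis (t : ℕ → ℝ) (k n i : ℕ) (s : ℝ) : ℝ :=
  ∏ m ∈ (Finset.range k).erase i,
    (∑ j ∈ Finset.Icc 1 m, stepSize t (n - j) + s) /
      (∑ j ∈ Finset.Icc 1 m, stepSize t (n - j) - ∑ j ∈ Finset.Icc 1 i, stepSize t (n - j))

/-- `u^{n+1}` arises from `u^n, …, u^{n-k+1}` by one step of the scheme: there is a continuous
`w : [t_n, t_{n+1}] → H` with `w(t_n) = u^n`, `w(t_{n+1}) = u^{n+1}` that solves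
`w' + ε L w + A τ^k (L^p w)' = ∑_{i<k} ℓ_i(· - t_n) F(u^{n-i})`, tested with
`φ ∈ D(L) ∩ D(L^p) ∩ V^β`. -/
def PosDefOp.IsETDStep {H : Type*} [NormedAddCommGroup H] [InnerProductSpace ℝ H]
    [CompleteSpace H] (L : PosDefOp H) (ε A p τ : ℝ) (k : ℕ) {β γ : ℝ}
    (F : L.V γ → L.VDual β) (t : ℕ → ℝ) (U : ℕ → L.V γ) (n : ℕ) : Prop :=
  ∃ w : ℝ → H, ContinuousOn w (Icc (t n) (t (n + 1))) ∧
    w (t n) = L.toH (U n) ∧ w (t (n + 1)) = L.toH (U (n + 1)) ∧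
    ∀ s ∈ Icc (t n) (t (n + 1)), ∀ (φ : L.V β) (hφ : L.toH φ ∈ L.op.domain)
      (hφ' : L.toH φ ∈ (L.pow p).domain),
      HasDerivWithinAt
        (fun r => inner ℝ (w r) (L.toH φ) + A * τ ^ k * inner ℝ (w r) (L.pow p ⟨L.toH φ, hφ'⟩))
        (∑ i ∈ Finset.range k, lagrangeBasis t k n i (s - t n) * F (U (n - i)) φ
          - ε * inner ℝ (w s) (L.op ⟨L.toH φ, hφ⟩))
        (Icc (t n) (t (n + 1))) s

open scoped Topology
open Filter

namespace PosDefOp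

variable {H : Type*} [NormedAddCommGroup H] [InnerProductSpace ℝ H] [CompleteSpace H]
  (L : PosDefOp H)

/-! ### Commutation of the bounded powers and the resolvent of `L⁻¹` -/

/-! On `[t_n, t_{n+1}]` the error `e = u - w` solves `e' + a L^p e' + ε L e = L^{β/2} ρ` with `a = A
τ^k`. Here `ρ` is the sum of the interpolation error of `F(u)`, read in `H` through Riesz
representatives, and the stabilization defect `a V₁`, where `L^p u' = L^{β/2} V₁`; the regularity `u
∈ H^1(V^{2p-β})` puts `V₁` in `L²`.

Testing with `L^{1-β} e` produces the energy `‖e‖²_{V^λ} + a ‖e‖²_{V^{p+λ}}` and the dissipation `ε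
‖L^{1-β/2} e‖²`. The source pairs with exactly the same power `L^{1-β/2} e`, so Young's inequality
absorbs it completely, and one step costs at most `(2ε)⁻¹ ∫ ‖ρ‖²` (`eNormV_energy_le`,
`eNormV_sub_le`).

The size of `ρ` has three sources (`norm_sub_lagrange_perturbed_sq_le`,
`integral_norm_add_smul_sq_le`). Interpolation of degree `k - 1` in an `H^k` function leaves
`τ^{2k-1} ∫ ‖h_k‖²` pointwise, with `h_k` the weak derivative of order `k`, hence `τ^{2k}` after
integration over a step. The Lipschitz bound and `V^λ ⊆ V^γ`, which holds since `γ ≤ 1 - β`, turn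
old errors into a multiple of their energies times the step size. The stabilization leaves `A²
τ^{2k} ∫ ‖V₁‖²`. The ratio bound `r` controls the Lagrange coefficients. `multistep_gronwall` sums
the steps.

The test vector `L^{1-β} e` need not make sense for a weak solution. All equations are therefore
tested only against the range of `L^{-m}` for one large integer `m`, and positive powers are
regularized: with `R_d = (L⁻¹ + d)⁻¹`, the bounded operator `R_d^m L^{-(m-s)}` stands for `L^s`. On
`L^{-s} g` it gives `(R_d L⁻¹)^m g`, which has norm at most `‖g‖` and tends to `g`. Bounds uniform
in `d` thus give both membership in `V^s` and the norm estimate (`eNormV_sq_add_le_of_res_bound`).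
The remaining analytic point is that the nodes form a null set, so a.e. representatives must be
upgraded to identities at every time (`IsSolution.exists_primitive`, `IsSolution.rep_eq`). -/

theorem invPow_mul_invPow {s r q : ℝ} (hs : 0 ≤ s) (hr : 0 ≤ r) (h : s + r = q) :
    L.invPow s * L.invPow r = L.invPow q := by
  rw [← L.invPow_add hs hr, h]

theorem commute_invPow {s r : ℝ} (hs : 0 ≤ s) (hr : 0 ≤ r) :
    Commute (L.invPow s) (L.invPow r) := by
  change _ * _ = _ * _
  rw [← L.invPow_add hs hr, ← L.invPow_add hr hs, add_comm]

theorem invPow_invPow {s r q : ℝ} (hs : 0 ≤ s) (hr : 0 ≤ r) (h : s + r = q) (x : H) :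
    L.invPow s (L.invPow r x) = L.invPow q x := by
  rw [← L.invPow_mul_invPow hs hr h]; rfl

/-- With `M = ‖L⁻¹‖`, one has `L⁻¹ + d = (M + d)(1 + M/(M + d) · shift)`. Since `‖shift‖ ≤ 1` and
`M/(M + d) < 1`, a Neumann series inverts the second factor. -/
theorem isUnit_inv_add {d : ℝ} (hd : 0 < d) : IsUnit (L.inv + d • (1 : H →L[ℝ] H)) := by
  rcases subsingleton_or_nontrivial H with h | h
  · have : Subsingleton (H →L[ℝ] H) := ⟨fun a b => by ext x; exact Subsingleton.elim _ _⟩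
    exact isUnit_of_subsingleton _
  have hM := L.norm_inv_pos
  set M := ‖L.inv‖ with hMdef
  have hMd : 0 < M + d := by positivity
  have hu : IsUnit (1 - (-(M / (M + d)) • L.shift)) := by
    apply isUnit_one_sub_of_norm_lt_one
    rw [norm_smul, norm_neg, Real.norm_of_nonneg (by positivity)]
    calc M / (M + d) * ‖L.shift‖ ≤ M / (M + d) * 1 := by
          gcongr; exact L.norm_shift_le
      _ < 1 := by rw [mul_one, div_lt_one hMd]; linarith
  have heq : L.inv + d • (1 : H →L[ℝ] H)
      = (M + d) • (1 - (-(M / (M + d)) • L.shift)) := by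
    rw [shift, ← hMdef, smul_sub, smul_smul, smul_sub, smul_smul]
    have h1 : (M + d) * -(M / (M + d)) * M⁻¹ = -1 := by field_simp
    have h2 : (M + d) * -(M / (M + d)) = -M := by field_simp
    rw [h1, h2]
    module
  rw [heq]
  exact hu.smul (Units.mk0 _ hMd.ne')

/-- The resolvent `(L⁻¹ + d)⁻¹`, for `d > 0`. -/
noncomputable def res (d : ℝ) : H →L[ℝ] H := Ring.inverse (L.inv + d • (1 : H →L[ℝ] H))

theorem res_mul {d : ℝ} (hd : 0 < d) : L.res d * (L.inv + d • (1 : H →L[ℝ] H)) = 1 :=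
  Ring.inverse_mul_cancel _ (L.isUnit_inv_add hd)

theorem mul_res {d : ℝ} (hd : 0 < d) : (L.inv + d • (1 : H →L[ℝ] H)) * L.res d = 1 :=
  Ring.mul_inverse_cancel _ (L.isUnit_inv_add hd)

theorem commute_res {d : ℝ} (hd : 0 < d) {B : H →L[ℝ] H} (hB : Commute B L.inv) :
    Commute B (L.res d) := by
  have h : Commute B (L.inv + d • (1 : H →L[ℝ] H)) :=
    hB.add_right ((Commute.one_right B).smul_right d)
  change B * L.res d = L.res d * B
  calc B * L.res d = (L.res d * (L.inv + d • (1 : H →L[ℝ] H))) * (B * L.res d) := by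
        rw [L.res_mul hd, one_mul]
    _ = L.res d * (B * (L.inv + d • (1 : H →L[ℝ] H))) * L.res d := by
        rw [h.eq]; simp only [mul_assoc]
    _ = L.res d * B * ((L.inv + d • (1 : H →L[ℝ] H)) * L.res d) := by simp only [mul_assoc]
    _ = L.res d * B := by rw [L.mul_res hd, mul_one]

theorem commute_invPow_res {d s : ℝ} (hd : 0 < d) (hs : 0 ≤ s) :
    Commute (L.invPow s) (L.res d) :=
  L.commute_res hd (L.invPow_one ▸ L.commute_invPow hs zero_le_one)

theorem res_symm {d : ℝ} (hd : 0 < d) (x y : H) :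
    inner ℝ (L.res d x) y = inner ℝ x (L.res d y) := by
  have h : ∀ z, L.inv (L.res d z) + d • L.res d z = z := fun z =>
    congrArg (fun A : H →L[ℝ] H => A z) (L.mul_res hd)
  conv_lhs => rw [← h y]
  conv_rhs => rw [← h x]
  simp only [inner_add_left, inner_add_right, real_inner_smul_left, real_inner_smul_right,
    L.inv_symm]

theorem res_pow_symm {d : ℝ} (hd : 0 < d) (m : ℕ) (x y : H) :
    inner ℝ ((L.res d ^ m) x) y = inner ℝ x ((L.res d ^ m) y) := by
  induction m generalizing x y with
  | zero => simp
  | succ m ih =>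
    rw [pow_succ, mul_apply_eq_comp, ih, L.res_symm hd, ← mul_apply_eq_comp, ← pow_succ', pow_succ]

/-- For `y = R_d x`, expand `‖x‖² = ‖L⁻¹ y + d y‖²`; the cross term is nonnegative because `L⁻¹ ≥
0`, so each square is bounded by `‖x‖²`. -/
theorem norm_inv_res_le {d : ℝ} (hd : 0 < d) (x : H) :
    ‖L.inv (L.res d x)‖ ≤ ‖x‖ ∧ ‖d • L.res d x‖ ≤ ‖x‖ := by
  have h : L.inv (L.res d x) + d • L.res d x = x :=
    congrArg (fun A : H →L[ℝ] H => A x) (L.mul_res hd)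
  set y := L.res d x
  have h1 := norm_add_sq_real (L.inv y) (d • y)
  rw [h, real_inner_smul_right] at h1
  have h2 := mul_nonneg hd.le (L.inv_nonneg y)
  exact ⟨le_of_sq_le_sq (by nlinarith [sq_nonneg ‖d • y‖]) (norm_nonneg _),
    le_of_sq_le_sq (by nlinarith [sq_nonneg ‖L.inv y‖]) (norm_nonneg _)⟩

/-- The contraction `(L⁻¹ + d)⁻¹ L⁻¹`, which tends strongly to the identity as `d → 0`. -/
noncomputable def approx (d : ℝ) : H →L[ℝ] H := L.res d * L.inv

theorem approx_apply {d : ℝ} (hd : 0 < d) (x : H) : L.approx d x = L.inv (L.res d x) := by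
  rw [approx, ← (L.commute_res hd (Commute.refl L.inv)).eq]; rfl

theorem norm_approx_pow_le {d : ℝ} (hd : 0 < d) (m : ℕ) (x : H) :
    ‖(L.approx d ^ m) x‖ ≤ ‖x‖ := by
  induction m with
  | zero => simp
  | succ m ih =>
    rw [pow_succ', mul_apply_eq_comp, L.approx_apply hd]
    exact (L.norm_inv_res_le hd _).1.trans ih

/-! ### Density of the ranges of negative powers and strong convergence of the regularization. -/

theorem dense_range_invPow {s : ℝ} (hs : 0 ≤ s) :
    Dense (LinearMap.range (L.invPow s : H →ₗ[ℝ] H) : Set H) := by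
  rw [Submodule.dense_iff_topologicalClosure_eq_top, Submodule.topologicalClosure_eq_top_iff,
    eq_bot_iff]
  intro v hv
  have h : ∀ h, inner ℝ (L.invPow s h) v = 0 := fun h => hv _ ⟨h, rfl⟩
  have h1 := h (L.invPow s v)
  rw [L.invPow_symm hs, real_inner_self_eq_norm_sq] at h1
  have h2 : L.invPow s v = 0 := by simpa using h1
  exact L.invPow_injective hs (by rw [h2, map_zero])

theorem ext_invPow {s : ℝ} (hs : 0 ≤ s) {x y : H}
    (h : ∀ z, inner ℝ x (L.invPow s z) = inner ℝ y (L.invPow s z)) : x = y := by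
  apply L.invPow_injective hs
  refine ext_inner_right ℝ fun z => ?_
  rw [L.invPow_symm hs, L.invPow_symm hs, h]

theorem tendsto_approx (x : H) : Tendsto (fun d => L.approx d x) (𝓝[>] 0) (𝓝 x) := by
  have hd := L.dense_range_invPow zero_le_one
  rw [L.invPow_one] at hd
  rw [Metric.tendsto_nhds]
  intro η hη
  obtain ⟨_, hz, z, rfl⟩ := Metric.dense_iff.1 hd x (η / 2) (by positivity)
  have hz' : ‖x - L.inv z‖ < η / 2 := by
    rw [Metric.mem_ball, dist_comm, dist_eq_norm] at hz
    exact hz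
  have hev : ∀ᶠ d : ℝ in 𝓝[>] 0, d < η / (2 * (‖z‖ + 1)) :=
    nhdsWithin_le_nhds (eventually_lt_nhds (by positivity))
  filter_upwards [hev, self_mem_nhdsWithin] with d hd1 (hd0 : 0 < d)
  have h : L.inv (L.res d x) + d • L.res d x = x :=
    congrArg (fun A : H →L[ℝ] H => A x) (L.mul_res hd0)
  -- Both `1 - R_d L⁻¹ = d R_d` and `d R_d L⁻¹ = d · approx d` are used: the first on the small
  -- remainder `x - L⁻¹ z`, where `d R_d` is a contraction, the second on `L⁻¹ z`, where the factor
  -- `d` gives smallness.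
  have h1 : L.approx d x - x = -(d • L.res d (x - L.inv z)) - d • L.approx d z := by
    rw [L.approx_apply hd0]
    have : L.approx d z = L.res d (L.inv z) := rfl
    rw [this, map_sub, smul_sub]
    nth_rw 2 [← h]
    abel
  rw [dist_eq_norm, h1]
  have h2 : ‖d • L.approx d z‖ < η / 2 := by
    rw [norm_smul, Real.norm_of_nonneg hd0.le]
    have : ‖L.approx d z‖ ≤ ‖z‖ := by
      rw [L.approx_apply hd0]; exact (L.norm_inv_res_le hd0 z).1
    have h3 : d * (2 * (‖z‖ + 1)) < η := by
      rwa [lt_div_iff₀ (by positivity)] at hd1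
    nlinarith
  calc _ ≤ ‖d • L.res d (x - L.inv z)‖ + ‖d • L.approx d z‖ := by
        refine (norm_sub_le _ _).trans (by rw [norm_neg])
    _ < η := by linarith [(L.norm_inv_res_le hd0 (x - L.inv z)).2]

theorem tendsto_approx_pow (m : ℕ) (x : H) :
    Tendsto (fun d => (L.approx d ^ m) x) (𝓝[>] 0) (𝓝 x) := by
  induction m with
  | zero => simp
  | succ m ih =>
    have h1 : Tendsto (fun d => (L.approx d ^ m) (L.approx d x - x)) (𝓝[>] 0) (𝓝 0) := by
      have h2 : Tendsto (fun d => ‖L.approx d x - x‖) (𝓝[>] 0) (𝓝 0) :=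
        (tendsto_iff_norm_sub_tendsto_zero.1 (L.tendsto_approx x))
      refine squeeze_zero_norm' ?_ h2
      filter_upwards [self_mem_nhdsWithin] with d hd
      exact L.norm_approx_pow_le hd m _
    have h3 := h1.add ih
    rw [zero_add] at h3
    refine h3.congr fun d => ?_
    rw [map_sub, pow_succ, mul_apply_eq_comp, sub_add_cancel]

theorem approx_pow {d : ℝ} (hd : 0 < d) (m : ℕ) :
    L.approx d ^ m = L.res d ^ m * L.invPow m := by
  rw [approx, (L.commute_res hd (Commute.refl L.inv)).symm.mul_pow, invPow_natCast]

/-- This is the sense in which `R_d^m L^{-(m-s)}` is a bounded substitute for `L^s`. -/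
theorem res_pow_invPow_invPow {d s : ℝ} (hd : 0 < d) (hs : 0 ≤ s) {m : ℕ} (hm : s ≤ m) (x : H) :
    (L.res d ^ m) (L.invPow (m - s) (L.invPow s x)) = (L.approx d ^ m) x := by
  rw [L.invPow_invPow (by linarith) hs (sub_add_cancel _ _), L.approx_pow hd]; rfl

/-! ### The `V^s`-norm -/

theorem eNormV_invPow {s : ℝ} (hs : 0 ≤ s) (g : H) :
    L.eNormV s (L.invPow (s / 2) g) = ‖g‖ₑ := by
  have h : L.invPow (s / 2) g ∈ (L.pow (s / 2)).domain :=
    (L.mem_pow_domain (by linarith) _).2 ⟨g, rfl⟩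
  rw [eNormV, dif_pos h, L.pow_apply_eq (by linarith) _ g rfl]

theorem exists_of_eNormV_ne_top {s : ℝ} (hs : 0 ≤ s) {v : H} (h : L.eNormV s v ≠ ⊤) :
    ∃ g, v = L.invPow (s / 2) g := by
  rw [eNormV] at h
  split_ifs at h with h1
  · obtain ⟨g, hg⟩ := (L.mem_pow_domain (by linarith) _).1 h1
    exact ⟨g, hg.symm⟩
  · exact absurd rfl h

/-- The hypothesis makes `L^{-s} z ↦ (e, z)` a bounded functional on the range of `L^{-s}`. Extend
it by Hahn–Banach and represent it by `g`; then `(g, L^{-s} z) = (e, z)` for all `z`, and symmetry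
of `L^{-s}` finishes. -/
theorem exists_invPow_eq_of_inner_le {s C : ℝ} (hs : 0 ≤ s) {e : H}
    (h : ∀ z, inner ℝ e z ≤ C * ‖L.invPow s z‖) : ∃ g, e = L.invPow s g := by
  set E := LinearEquiv.ofInjective (L.invPow s : H →ₗ[ℝ] H) (L.invPow_injective hs)
  let f₀ : LinearMap.range (L.invPow s : H →ₗ[ℝ] H) →ₗ[ℝ] ℝ :=
    ((innerSL ℝ e : H →L[ℝ] ℝ) : H →ₗ[ℝ] ℝ) ∘ₗ E.symm.toLinearMap
  have hf₀ : ∀ z, f₀ (E z) = inner ℝ e z := fun z => by simp [f₀]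
  let f : StrongDual ℝ (LinearMap.range (L.invPow s : H →ₗ[ℝ] H)) :=
    f₀.mkContinuous C fun y => by
      obtain ⟨z, rfl⟩ := E.surjective y
      rw [hf₀, Real.norm_eq_abs, abs_le]
      have h1 := h (-z)
      rw [inner_neg_right, map_neg, norm_neg] at h1
      have h2 : ‖E z‖ = ‖L.invPow s z‖ := rfl
      rw [h2]
      exact ⟨by linarith, h z⟩
  obtain ⟨g, hg, -⟩ := exists_extension_norm_eq _ f
  refine ⟨(InnerProductSpace.toDual ℝ H).symm g, ?_⟩
  refine ext_inner_right ℝ fun z => ?_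
  rw [L.invPow_symm hs, InnerProductSpace.toDual_symm_apply]
  exact ((hg (E z)).trans (hf₀ z)).symm

/-- Moving one factor `L^{-s}` across the inner product bounds `((R_d L⁻¹)^m e, z)` by `C ‖L^{-s}
z‖`; let `d → 0`. -/
theorem exists_invPow_eq_of_res_bound {s C : ℝ} (hs : 0 ≤ s) {m : ℕ} (hm : s ≤ m) {e : H}
    (h : ∀ d, 0 < d → ‖(L.res d ^ m) (L.invPow (m - s) e)‖ ≤ C) : ∃ g, e = L.invPow s g := by
  refine L.exists_invPow_eq_of_inner_le hs (C := C) fun z => ?_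
  have h1 := (L.tendsto_approx_pow m e).inner (tendsto_const_nhds (x := z)) (𝕜 := ℝ)
  refine le_of_tendsto h1 ?_
  filter_upwards [self_mem_nhdsWithin] with d hd
  have hd' : 0 < d := hd
  have h2 : inner ℝ ((L.approx d ^ m) e) z
      = inner ℝ ((L.res d ^ m) (L.invPow (m - s) e)) (L.invPow s z) := by
    rw [← L.invPow_symm hs]
    congr 1
    have hc := (L.commute_invPow_res hd' hs).pow_right m
    have h3 : L.invPow s ((L.res d ^ m) (L.invPow (m - s) e))
        = (L.res d ^ m) (L.invPow s (L.invPow (m - s) e)) :=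
      congrArg (fun A : H →L[ℝ] H => A (L.invPow (m - s) e)) hc.eq
    rw [h3, L.invPow_invPow hs (by linarith) (q := m) (by ring), L.approx_pow hd']
    rfl
  rw [h2]
  exact (real_inner_le_norm _ _).trans (by gcongr; exact h d hd')

/-- The way back from regularized estimates: a bound uniform in `d` yields preimages under the
negative powers, and the regularized norms then converge to the true ones. -/
theorem eNormV_sq_add_le_of_res_bound {s q a B : ℝ} (hs : 0 ≤ s) (hq : 0 ≤ q) (ha : 0 ≤ a)
    {m : ℕ} (hsm : s / 2 ≤ m) (hqm : q / 2 ≤ m) {e : H}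
    (h : ∀ d, 0 < d → ‖(L.res d ^ m) (L.invPow (m - s / 2) e)‖ ^ 2
      + a * ‖(L.res d ^ m) (L.invPow (m - q / 2) e)‖ ^ 2 ≤ B) :
    L.eNormV s e ^ 2 + ENNReal.ofReal a * L.eNormV q e ^ 2 ≤ ENNReal.ofReal B := by
  obtain ⟨g, hg⟩ := L.exists_invPow_eq_of_res_bound (s := s / 2) (C := √B) (by linarith) hsm
    (e := e) fun d hd => Real.le_sqrt_of_sq_le (by
      have := h d hd
      have h1 : 0 ≤ a * ‖(L.res d ^ m) (L.invPow (m - q / 2) e)‖ ^ 2 := by positivity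
      linarith)
  have hlim : ∀ g' : H, Tendsto (fun d => ‖(L.approx d ^ m) g'‖ ^ 2) (𝓝[>] 0) (𝓝 (‖g'‖ ^ 2)) :=
    fun g' => (L.tendsto_approx_pow m g').norm.pow 2
  have hsq : ∀ g' : H, ‖g'‖ₑ ^ 2 = ENNReal.ofReal (‖g'‖ ^ 2) := fun g' => by
    rw [← ofReal_norm, ENNReal.ofReal_pow (norm_nonneg _)]
  -- For `a = 0` nothing is known about membership in `V^q`, and the convention `0 * ⊤ = 0` removes
  -- that term; for `a > 0` the bound can be divided by `a`.
  rcases eq_or_lt_of_le ha with rfl | ha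
  · rw [ENNReal.ofReal_zero, zero_mul, add_zero, hg, L.eNormV_invPow hs, hsq]
    refine ENNReal.ofReal_le_ofReal (le_of_tendsto (hlim g) ?_)
    filter_upwards [self_mem_nhdsWithin] with d hd
    have := h d hd
    rwa [zero_mul, add_zero, hg, L.res_pow_invPow_invPow hd (by linarith) hsm] at this
  · obtain ⟨g', hg'⟩ := L.exists_invPow_eq_of_res_bound (s := q / 2) (C := √(B / a))
      (by linarith) hqm (e := e) fun d hd => Real.le_sqrt_of_sq_le (by
        have := h d hd
        rw [le_div_iff₀ ha]
        nlinarith [sq_nonneg ‖(L.res d ^ m) (L.invPow (m - s / 2) e)‖])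
    have h1 : ‖g‖ ^ 2 + a * ‖g'‖ ^ 2 ≤ B := by
      refine le_of_tendsto ((hlim g).add ((hlim g').const_mul a)) ?_
      filter_upwards [self_mem_nhdsWithin] with d hd
      have := h d hd
      rw [← L.res_pow_invPow_invPow hd (by linarith) hsm,
        ← L.res_pow_invPow_invPow hd (by linarith) hqm, ← hg, ← hg']
      exact this
    have e1 : L.eNormV s e = ‖g‖ₑ := by rw [hg, L.eNormV_invPow hs]
    have e2 : L.eNormV q e = ‖g'‖ₑ := by rw [hg', L.eNormV_invPow hq]
    rw [e1, e2, hsq, hsq, ← ENNReal.ofReal_mul ha.le,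
      ← ENNReal.ofReal_add (by positivity) (by positivity)]
    exact ENNReal.ofReal_le_ofReal h1

theorem res_norm_sq_add_le {s q a B d : ℝ} (hs : 0 ≤ s) (hq : 0 ≤ q) (ha : 0 ≤ a) (hd : 0 < d)
    (hB : 0 ≤ B) {m : ℕ} (hsm : s / 2 ≤ m) (hqm : q / 2 ≤ m) {e : H}
    (h : L.eNormV s e ^ 2 + ENNReal.ofReal a * L.eNormV q e ^ 2 ≤ ENNReal.ofReal B) :
    ‖(L.res d ^ m) (L.invPow (m - s / 2) e)‖ ^ 2
      + a * ‖(L.res d ^ m) (L.invPow (m - q / 2) e)‖ ^ 2 ≤ B := by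
  have hne := (h.trans_lt ENNReal.ofReal_lt_top).ne
  have hsq : ∀ g' : H, ‖g'‖ₑ ^ 2 = ENNReal.ofReal (‖g'‖ ^ 2) := fun g' => by
    rw [← ofReal_norm, ENNReal.ofReal_pow (norm_nonneg _)]
  obtain ⟨g, hg⟩ := L.exists_of_eNormV_ne_top hs (v := e) fun h0 => hne (by simp [h0])
  have e1 : L.eNormV s e = ‖g‖ₑ := by rw [hg, L.eNormV_invPow hs]
  have b1 : ‖(L.res d ^ m) (L.invPow (m - s / 2) e)‖ ^ 2 ≤ ‖g‖ ^ 2 := by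
    rw [hg, L.res_pow_invPow_invPow hd (by linarith) hsm]
    gcongr
    exact L.norm_approx_pow_le hd m g
  rcases eq_or_lt_of_le ha with rfl | ha
  · rw [ENNReal.ofReal_zero, zero_mul, add_zero, e1, hsq] at h
    rw [zero_mul, add_zero]
    exact b1.trans ((ENNReal.ofReal_le_ofReal_iff hB).1 h)
  · obtain ⟨g', hg'⟩ := L.exists_of_eNormV_ne_top hq (v := e) fun h0 => hne (by
      rw [h0]
      simp [ENNReal.mul_top, ha])
    have e2 : L.eNormV q e = ‖g'‖ₑ := by rw [hg', L.eNormV_invPow hq]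
    rw [e1, e2, hsq, hsq, ← ENNReal.ofReal_mul ha.le,
      ← ENNReal.ofReal_add (by positivity) (by positivity), ENNReal.ofReal_le_ofReal_iff hB] at h
    refine le_trans (add_le_add b1 ?_) h
    rw [hg', L.res_pow_invPow_invPow hd (by linarith) hqm]
    gcongr
    exact L.norm_approx_pow_le hd m g'

/-! ### `V^s` and `V^{-s}` as copies of `H` -/

theorem powV_surjective {s : ℝ} (hs : 0 ≤ s) : Function.Surjective (L.powV s) := fun w =>
  ⟨⟨L.invPow (s / 2) w, (L.mem_pow_domain (by linarith) _).2 ⟨w, rfl⟩⟩,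
    L.pow_apply_eq (by linarith) _ w rfl⟩

theorem invPow_powV {s : ℝ} (hs : 0 ≤ s) (v : L.V s) :
    L.invPow (s / 2) (L.powV s v) = L.toH v :=
  L.invPow_pow (by linarith) _

theorem norm_powV {s : ℝ} (v : L.V s) : ‖L.powV s v‖ = ‖v‖ := rfl

/-- `L^{s/2}` as an isometric isomorphism `V^s ≃ H`, for `s ≥ 0`. -/
noncomputable def isoV {s : ℝ} (hs : 0 ≤ s) : L.V s ≃ₗᵢ[ℝ] H :=
  LinearIsometryEquiv.ofSurjective ⟨L.powV s, fun _ => rfl⟩ (L.powV_surjective hs)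

theorem isoV_apply {s : ℝ} (hs : 0 ≤ s) (v : L.V s) : L.isoV hs v = L.powV s v := rfl

theorem toH_isoV_symm {s : ℝ} (hs : 0 ≤ s) (h : H) :
    L.toH ((L.isoV hs).symm h) = L.invPow (s / 2) h := by
  rw [← L.invPow_powV hs, ← L.isoV_apply hs, LinearIsometryEquiv.apply_symm_apply]

/-- The Riesz representative `ρ` of `R ∈ V^{-s}`: `R v = (ρ, L^{s/2} v)`. -/
noncomputable def rep {s : ℝ} (hs : 0 ≤ s) : L.VDual s →L[ℝ] H :=
  LinearMap.mkContinuous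
    { toFun := fun R => (InnerProductSpace.toDual ℝ H).symm
        (R.comp ((L.isoV hs).symm.toContinuousLinearEquiv : H →L[ℝ] L.V s))
      map_add' := fun R R' => by
        rw [ContinuousLinearMap.add_comp, map_add]
      map_smul' := fun c R => by
        rw [ContinuousLinearMap.smul_comp, map_smulₛₗ]
        rfl } 1 fun R => by
    simp only [LinearMap.coe_mk, AddHom.coe_mk, LinearIsometryEquiv.norm_map, one_mul]
    refine ContinuousLinearMap.opNorm_le_bound _ (norm_nonneg _) fun x => ?_
    refine (R.le_opNorm _).trans_eq ?_
    congr 1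
    exact (L.isoV hs).symm.norm_map x

theorem inner_rep {s : ℝ} (hs : 0 ≤ s) (R : L.VDual s) (h : H) :
    inner ℝ (L.rep hs R) h = R ((L.isoV hs).symm h) :=
  InnerProductSpace.toDual_symm_apply

theorem norm_rep_le {s : ℝ} (hs : 0 ≤ s) (R : L.VDual s) : ‖L.rep hs R‖ ≤ ‖R‖ := by
  have h := (L.rep hs).le_of_opNorm_le (LinearMap.mkContinuous_norm_le _ zero_le_one _) R
  rwa [one_mul] at h

end PosDefOp

/-! ### The energy identity for weakly absolutely continuous functions -/

/-- Sum the increments over a fine uniform partition: the right-hand sides telescope to `η (m b - m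
a)`, and `η` is arbitrary. This replaces differentiation, which is unavailable for a merely
integrable source. -/
theorem eq_of_forall_abs_sub_le_mul {a b : ℝ} (hab : a ≤ b) {Ψ m : ℝ → ℝ}
    (h : ∀ η > 0, ∃ d > 0, ∀ s ∈ Icc a b, ∀ t ∈ Icc a b, s ≤ t → t - s < d →
      |Ψ t - Ψ s| ≤ η * (m t - m s)) : Ψ b = Ψ a := by
  have key : ∀ η > 0, |Ψ b - Ψ a| ≤ η * (m b - m a) := by
    intro η hη
    obtain ⟨d, hd, hΨ⟩ := h η hη
    obtain ⟨n, hn⟩ := exists_nat_gt ((b - a) / d)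
    have hn0 : 0 < (n : ℝ) := lt_of_le_of_lt (by have := sub_nonneg.2 hab; positivity) hn
    set x : ℕ → ℝ := fun i => a + i * ((b - a) / n) with hx
    have hba : 0 ≤ (b - a) / n := div_nonneg (sub_nonneg.2 hab) hn0.le
    have hx0 : x 0 = a := by simp [hx]
    have hxn : x n = b := by simp only [hx]; field_simp; ring
    have hmem : ∀ i ≤ n, x i ∈ Icc a b := by
      intro i hi
      have hi' : (i : ℝ) ≤ n := by exact_mod_cast hi
      refine ⟨by simp only [hx]; nlinarith [mul_nonneg i.cast_nonneg hba], ?_⟩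
      rw [← hxn]
      simp only [hx]
      gcongr
    have hstep : ∀ i, x (i + 1) - x i = (b - a) / n := fun i => by
      simp only [hx]; push_cast; ring
    have hlt : (b - a) / n < d := by
      rw [div_lt_iff₀ hn0]; rw [div_lt_iff₀ hd] at hn; linarith
    calc |Ψ b - Ψ a| = |∑ i ∈ Finset.range n, (Ψ (x (i + 1)) - Ψ (x i))| := by
          rw [Finset.sum_range_sub (fun i => Ψ (x i)), hx0, hxn]
      _ ≤ ∑ i ∈ Finset.range n, |Ψ (x (i + 1)) - Ψ (x i)| := Finset.abs_sum_le_sum_abs _ _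
      _ ≤ ∑ i ∈ Finset.range n, η * (m (x (i + 1)) - m (x i)) := by
          refine Finset.sum_le_sum fun i hi => ?_
          have hi' := Finset.mem_range.1 hi
          exact hΨ _ (hmem i hi'.le) _ (hmem (i + 1) hi') (by linarith [hstep i])
            (by rw [hstep]; exact hlt)
      _ = η * (m b - m a) := by
          rw [← Finset.mul_sum, Finset.sum_range_sub (fun i => m (x i)), hx0, hxn]
  have h0 : |Ψ b - Ψ a| ≤ 0 := by
    refine le_of_forall_pos_le_add fun η hη => ?_
    set D := |m b - m a| + 1
    have hD : 0 < D := by positivity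
    refine (key (η / D) (by positivity)).trans ?_
    calc η / D * (m b - m a) ≤ η / D * D := by
          gcongr
          exact (le_abs_self _).trans (by simp [D])
      _ = 0 + η := by field_simp; ring
  exact sub_eq_zero.1 (abs_eq_zero.1 (le_antisymm h0 (abs_nonneg _)))

section Energy

variable {H : Type*} [NormedAddCommGroup H] [InnerProductSpace ℝ H]

theorem IntervalIntegrable.inner_const {a b : ℝ} {f : ℝ → H}
    (hf : IntervalIntegrable f volume a b) (h : H) :
    IntervalIntegrable (fun s => inner ℝ (f s) h) volume a b :=
  ⟨hf.1.inner_const h, hf.2.inner_const h⟩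

theorem IntervalIntegrable.inner_continuousOn {a b : ℝ} (hab : a ≤ b) {e f : ℝ → H}
    (he : ContinuousOn e (Icc a b)) (hf : IntervalIntegrable f volume a b) :
    IntervalIntegrable (fun s => inner ℝ (e s) (f s)) volume a b := by
  obtain ⟨C, hC⟩ := isCompact_Icc.exists_bound_of_continuousOn he
  rw [intervalIntegrable_iff_integrableOn_Icc_of_le hab] at hf ⊢
  refine Integrable.mono' (g := fun s => C * ‖f s‖) (hf.norm.const_mul C) ?_ ?_
  · exact (he.aestronglyMeasurable measurableSet_Icc).inner hf.aestronglyMeasurable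
  · rw [ae_restrict_iff' measurableSet_Icc]
    refine Eventually.of_forall fun s hs => ?_
    refine (norm_inner_le_norm _ _).trans ?_
    gcongr
    exact hC s hs

/-- Formally `d/dt (P e, B e) = 2 (P e, (B e)')`, because the form `(P x, B y)` is symmetric. Here
`e` is only continuous and `B e` is a weak primitive of `f`, so the identity is obtained from
increments. -/
theorem integral_energy_eq {a b : ℝ} (hab : a ≤ b) {e f : ℝ → H} {P B : H →L[ℝ] H}
    (hPB : ∀ x y, inner ℝ (P x) (B y) = inner ℝ (P y) (B x))
    (he : ContinuousOn e (Icc a b)) (hf : IntervalIntegrable f volume a b)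
    (heq : ∀ s ∈ Icc a b, ∀ t ∈ Icc a b, s ≤ t → ∀ h : H,
      inner ℝ (B (e t)) h - inner ℝ (B (e s)) h = ∫ x in s..t, inner ℝ (f x) h) :
    inner ℝ (P (e b)) (B (e b)) - inner ℝ (P (e a)) (B (e a))
      = ∫ x in a..b, 2 * inner ℝ (P (e x)) (f x) := by
  have hPe : ContinuousOn (fun x => P (e x)) (Icc a b) := P.continuous.comp_continuousOn he
  have hint : IntervalIntegrable (fun x => 2 * inner ℝ (P (e x)) (f x)) volume a b :=
    (IntervalIntegrable.inner_continuousOn hab hPe hf).const_mul 2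
  have hsub : ∀ {s t : ℝ}, s ∈ Icc a b → t ∈ Icc a b → uIcc s t ⊆ uIcc a b := by
    intro s t hs ht
    rw [uIcc_of_le hab]
    exact uIcc_subset_Icc hs ht
  have ha : a ∈ Icc a b := left_mem_Icc.2 hab
  set Ψ : ℝ → ℝ := fun t =>
    inner ℝ (P (e t)) (B (e t)) - ∫ x in a..t, 2 * inner ℝ (P (e x)) (f x) with hΨ
  have key : Ψ b = Ψ a := by
    refine eq_of_forall_abs_sub_le_mul hab (m := fun t => ∫ x in a..t, ‖f x‖) fun η hη => ?_
    have huc := isCompact_Icc.uniformContinuousOn_of_continuous hPe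
    rw [Metric.uniformContinuousOn_iff] at huc
    obtain ⟨d, hd, hud⟩ := huc (η / 2) (by positivity)
    refine ⟨d, hd, fun s hs t ht hst htd => ?_⟩
    have i1 : ∫ x in a..t, 2 * inner ℝ (P (e x)) (f x) = (∫ x in a..s, 2 * inner ℝ (P (e x)) (f x))
        + ∫ x in s..t, 2 * inner ℝ (P (e x)) (f x) :=
      (intervalIntegral.integral_add_adjacent_intervals (hint.mono_set (hsub ha hs)) (hint.mono_set (hsub hs ht))).symm
    have i2 : (∫ x in a..t, ‖f x‖) - ∫ x in a..s, ‖f x‖ = ∫ x in s..t, ‖f x‖ := by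
      rw [intervalIntegral.integral_interval_sub_left (hf.norm.mono_set (hsub ha ht)) (hf.norm.mono_set (hsub ha hs))]
    -- A difference-of-squares factorization: symmetry of the form cancels the mixed terms, leaving
    -- the increment of `B e` paired with `P e(t) + P e(s)`.
    have i3 : inner ℝ (P (e t)) (B (e t)) - inner ℝ (P (e s)) (B (e s))
        = ∫ x in s..t, inner ℝ (f x) (P (e t) + P (e s)) := by
      rw [← heq s hs t ht hst, inner_add_right, inner_add_right, real_inner_comm _ (B (e t)),
        real_inner_comm _ (B (e t)), real_inner_comm _ (B (e s)), real_inner_comm _ (B (e s)),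
        hPB (e s) (e t)]
      ring
    have i4 : Ψ t - Ψ s = ∫ x in s..t, inner ℝ ((P (e t) - P (e x)) + (P (e s) - P (e x))) (f x) := by
      have h1 : Ψ t - Ψ s = (inner ℝ (P (e t)) (B (e t)) - inner ℝ (P (e s)) (B (e s)))
          - ∫ x in s..t, 2 * inner ℝ (P (e x)) (f x) := by
        simp only [hΨ]; rw [i1]; ring
      rw [h1, i3, ← intervalIntegral.integral_sub
        (IntervalIntegrable.inner_const (hf.mono_set (hsub hs ht)) _) (hint.mono_set (hsub hs ht))]
      refine intervalIntegral.integral_congr fun x _ => ?_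
      simp only [inner_add_left, inner_sub_left, inner_add_right]
      rw [real_inner_comm (P (e t)) (f x), real_inner_comm (P (e s)) (f x)]
      ring
    change |Ψ t - Ψ s| ≤ η * ((∫ x in a..t, ‖f x‖) - ∫ x in a..s, ‖f x‖)
    rw [i2, i4, ← intervalIntegral.integral_const_mul, ← Real.norm_eq_abs]
    refine intervalIntegral.norm_integral_le_of_norm_le hst ?_ ((hf.mono_set (hsub hs ht)).norm.const_mul η)
    refine Eventually.of_forall fun x hx => ?_
    have hxm : x ∈ Icc a b := ⟨hs.1.trans hx.1.le, hx.2.trans ht.2⟩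
    refine (norm_inner_le_norm _ _).trans ?_
    gcongr
    have h1 := hud t ht x hxm (by rw [Real.dist_eq, abs_of_nonneg (by linarith [hx.2])]; linarith [hx.1])
    have h2 := hud s hs x hxm (by rw [Real.dist_eq, abs_of_nonpos (by linarith [hx.1])]; linarith [hx.2])
    rw [dist_eq_norm] at h1 h2
    exact (norm_add_le _ _).trans (by linarith)
  simp only [hΨ, intervalIntegral.integral_same] at key
  linarith

end Energy

/-! ### The energy estimate in the scale `V^s`. -/

namespace PosDefOp

variable {H : Type*} [NormedAddCommGroup H] [InnerProductSpace ℝ H] [CompleteSpace H]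
  (L : PosDefOp H)

/-- All factors are symmetric and commute, so only the total exponents of `R_d` and `L⁻¹` matter.
This lets powers be redistributed freely between the two arguments. -/
theorem inner_res_pow_invPow {d : ℝ} (hd : 0 < d) {x y q : ℝ} (hx : 0 ≤ x) (hy : 0 ≤ y)
    (hq : x + y = q) {i j n : ℕ} (hn : i + j = n) (e e' : H) :
    inner ℝ ((L.res d ^ i) (L.invPow x e)) ((L.res d ^ j) (L.invPow y e'))
      = inner ℝ (L.invPow q e) ((L.res d ^ n) e') := by
  have hc : (L.res d ^ j) (L.invPow y e') = L.invPow y ((L.res d ^ j) e') :=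
    (congrArg (fun A : H →L[ℝ] H => A e') ((L.commute_invPow_res hd hy).pow_right j).eq).symm
  have hc' : (L.res d ^ i) (L.invPow y ((L.res d ^ j) e'))
      = L.invPow y ((L.res d ^ n) e') := by
    have := (congrArg (fun A : H →L[ℝ] H => A ((L.res d ^ j) e'))
      ((L.commute_invPow_res hd hy).pow_right i).eq).symm
    refine this.trans ?_
    rw [← hn, pow_add]; rfl
  rw [L.res_pow_symm hd, hc, hc', ← L.invPow_symm hy, L.invPow_invPow hy hx (q := q) (by rw [← hq, add_comm])]

/-- The energy argument with every positive power regularized; `m ≥ p + 2` keeps all exponents of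
`L⁻¹` nonnegative. The constants do not depend on `d`. -/
theorem res_energy_le {ε A β p a b d : ℝ} (hε : 0 < ε) (hβ : 0 ≤ β) (hβ1 : β ≤ 1) (hp : 0 ≤ p)
    (hd : 0 < d) (hab : a ≤ b) {m : ℕ} (hm : p + 2 ≤ m) {e ρ : ℝ → H}
    (he : ContinuousOn e (Icc a b)) (hρ : MemLp ρ 2 (volume.restrict (Ioc a b)))
    (heq : ∀ s ∈ Icc a b, ∀ t ∈ Icc a b, s ≤ t → ∀ h : H,
      inner ℝ ((L.invPow m + A • L.invPow (m - p)) (e t)) h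
          - inner ℝ ((L.invPow m + A • L.invPow (m - p)) (e s)) h
        = ∫ x in s..t, inner ℝ (L.invPow (m - β / 2) (ρ x) - ε • L.invPow (m - 1) (e x)) h) :
    ‖(L.res d ^ m) (L.invPow (m - (1 - β) / 2) (e b))‖ ^ 2
        + A * ‖(L.res d ^ m) (L.invPow (m - (p + (1 - β)) / 2) (e b))‖ ^ 2
      ≤ ‖(L.res d ^ m) (L.invPow (m - (1 - β) / 2) (e a))‖ ^ 2
        + A * ‖(L.res d ^ m) (L.invPow (m - (p + (1 - β)) / 2) (e a))‖ ^ 2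
        + (2 * ε)⁻¹ * ∫ x in a..b, ‖ρ x‖ ^ 2 := by
  -- Relative to `B`, which is `(1 + A L^p) L^{-m}`, this is the regularized test operator
  -- `L^{1-β}`: the surplus `m` in the power of `R_d` compensates the `L^{-m}` carried by the
  -- equation.
  set P : H →L[ℝ] H := L.res d ^ (2 * m) * L.invPow (m - (1 - β))
  set B : H →L[ℝ] H := L.invPow m + A • L.invPow (m - p)
  have hm0 : (0 : ℝ) ≤ m := by positivity
  have h2m : 2 * m + 0 = m + m := by ring
  have e0 : ∀ {y : ℝ} (x : H), L.invPow y x = (L.res d ^ 0) (L.invPow y x) := fun x => by simp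
  have hΦ : ∀ x y, inner ℝ (P x) (B y)
      = inner ℝ ((L.res d ^ m) (L.invPow (m - (1 - β) / 2) x))
          ((L.res d ^ m) (L.invPow (m - (1 - β) / 2) y))
        + A * inner ℝ ((L.res d ^ m) (L.invPow (m - (p + (1 - β)) / 2) x))
          ((L.res d ^ m) (L.invPow (m - (p + (1 - β)) / 2) y)) := by
    intro x y
    have hB : B y = L.invPow m y + A • L.invPow (m - p) y := rfl
    have hP : P x = (L.res d ^ (2 * m)) (L.invPow (m - (1 - β)) x) := rfl
    rw [hB, hP, inner_add_right, real_inner_smul_right, e0 (y := m) y, e0 (y := m - p) y,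
      L.inner_res_pow_invPow hd (by linarith) hm0 rfl h2m,
      L.inner_res_pow_invPow hd (by linarith) (by linarith) rfl h2m,
      L.inner_res_pow_invPow hd (by linarith) (by linarith)
        (q := m - (1 - β) + m) (by ring) rfl,
      L.inner_res_pow_invPow hd (by linarith) (by linarith)
        (q := m - (1 - β) + (m - p)) (by ring) rfl]
  have hρi : IntervalIntegrable ρ volume a b := by
    rw [intervalIntegrable_iff_integrableOn_Ioc_of_le hab]
    exact hρ.integrable (by norm_num)
  have hρ2 : IntervalIntegrable (fun x => ‖ρ x‖ ^ 2) volume a b := by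
    rw [intervalIntegrable_iff_integrableOn_Ioc_of_le hab]
    exact hρ.integrable_norm_pow (by norm_num)
  have hf : IntervalIntegrable
      (fun x => L.invPow (m - β / 2) (ρ x) - ε • L.invPow (m - 1) (e x)) volume a b := by
    refine IntervalIntegrable.sub ?_ ?_
    · exact ⟨(L.invPow (m - β / 2)).integrable_comp hρi.1, (L.invPow (m - β / 2)).integrable_comp hρi.2⟩
    · refine ContinuousOn.intervalIntegrable ?_
      rw [uIcc_of_le hab]
      exact ((L.invPow (m - 1)).continuous.comp_continuousOn he).const_smul ε
  have hPe : ContinuousOn (fun x => P (e x)) (Icc a b) := P.continuous.comp_continuousOn he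
  have hid := integral_energy_eq hab (P := P) (B := B) (fun x y => by
    rw [hΦ, hΦ, real_inner_comm, real_inner_comm (L.res d ^ m <| L.invPow (m - (p + (1 - β)) / 2) y)])
    he hf heq
  rw [hΦ, hΦ, real_inner_self_eq_norm_sq, real_inner_self_eq_norm_sq, real_inner_self_eq_norm_sq,
    real_inner_self_eq_norm_sq] at hid
  have hle : ∫ x in a..b, 2 * inner ℝ (P (e x))
        (L.invPow (m - β / 2) (ρ x) - ε • L.invPow (m - 1) (e x))
      ≤ ∫ x in a..b, (2 * ε)⁻¹ * ‖ρ x‖ ^ 2 := by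
    refine intervalIntegral.integral_mono_on hab
      ((IntervalIntegrable.inner_continuousOn hab hPe hf).const_mul 2) (hρ2.const_mul _) fun x _ => ?_
    have hP : P (e x) = (L.res d ^ (2 * m)) (L.invPow (m - (1 - β)) (e x)) := rfl
    rw [hP, inner_sub_right, real_inner_smul_right, e0 (y := m - β / 2), e0 (y := m - 1),
      L.inner_res_pow_invPow hd (by linarith) (by linarith) rfl h2m,
      L.inner_res_pow_invPow hd (by linarith) (by linarith) rfl h2m,
      -- Redistribute the exponents so that source and dissipation involve the same vector `X`, the
      -- regularized `L^{(2-β)/2} e`. Completing the square then absorbs the source.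
      ← L.inner_res_pow_invPow hd (x := m - (2 - β) / 2) (y := m) (by linarith) hm0
        (by ring) rfl,
      ← L.inner_res_pow_invPow hd (x := m - (2 - β) / 2) (y := m - (2 - β) / 2) (by linarith)
        (by linarith) (by ring) rfl, real_inner_self_eq_norm_sq]
    set X := (L.res d ^ m) (L.invPow (m - (2 - β) / 2) (e x))
    have hR : ‖(L.res d ^ m) (L.invPow m (ρ x))‖ ≤ ‖ρ x‖ := by
      have := L.norm_approx_pow_le hd m (ρ x)
      rwa [L.approx_pow hd] at this
    have h1 := (real_inner_le_norm X ((L.res d ^ m) (L.invPow m (ρ x)))).trans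
      (mul_le_mul_of_nonneg_left hR (norm_nonneg X))
    have h2 : 2 * (‖X‖ * ‖ρ x‖ - ε * ‖X‖ ^ 2)
        = (2 * ε)⁻¹ * ‖ρ x‖ ^ 2 - (2 * ε)⁻¹ * (2 * ε * ‖X‖ - ‖ρ x‖) ^ 2 := by
      field_simp; ring
    have h3 : 0 ≤ (2 * ε)⁻¹ * (2 * ε * ‖X‖ - ‖ρ x‖) ^ 2 := by positivity
    linarith
  rw [intervalIntegral.integral_const_mul, intervalIntegral.integral_const_mul] at hle
  rw [intervalIntegral.integral_const_mul] at hid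
  linarith

/-- The energy estimate for `e' + A (L^p e)' + ε L e = L^{β/2} ρ`, tested against the range of
`L^{-m}`. -/
theorem eNormV_energy_le {ε A β p a b E : ℝ} (hε : 0 < ε) (hA : 0 ≤ A) (hβ : 0 ≤ β) (hβ1 : β ≤ 1)
    (hp : 0 ≤ p) (hab : a ≤ b) (hE : 0 ≤ E) {m : ℕ} (hm : p + 2 ≤ m) {e ρ : ℝ → H}
    (he : ContinuousOn e (Icc a b)) (hρ : MemLp ρ 2 (volume.restrict (Ioc a b)))
    (heq : ∀ s ∈ Icc a b, ∀ t ∈ Icc a b, s ≤ t → ∀ h : H,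
      inner ℝ ((L.invPow m + A • L.invPow (m - p)) (e t)) h
          - inner ℝ ((L.invPow m + A • L.invPow (m - p)) (e s)) h
        = ∫ x in s..t, inner ℝ (L.invPow (m - β / 2) (ρ x) - ε • L.invPow (m - 1) (e x)) h)
    (hinit : L.eNormV (1 - β) (e a) ^ 2
      + ENNReal.ofReal A * L.eNormV (p + (1 - β)) (e a) ^ 2 ≤ ENNReal.ofReal E) :
    L.eNormV (1 - β) (e b) ^ 2 + ENNReal.ofReal A * L.eNormV (p + (1 - β)) (e b) ^ 2
      ≤ ENNReal.ofReal (E + (2 * ε)⁻¹ * ∫ x in a..b, ‖ρ x‖ ^ 2) := by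
  refine L.eNormV_sq_add_le_of_res_bound (by linarith) (by linarith) hA (m := m) (by linarith)
    (by linarith) fun d hd => ?_
  have h1 := L.res_norm_sq_add_le (by linarith) (by linarith) hA hd hE (m := m) (by linarith)
    (by linarith) hinit
  have h2 := L.res_energy_le hε hβ hβ1 hp hd hab hm he hρ heq
  linarith

end PosDefOp

/-! ### Weak derivatives and primitives -/

section WeakDeriv

variable {X : Type*} [NormedAddCommGroup X] [NormedSpace ℝ X]

theorem integral_deriv_mul_primitive {T : ℝ} {g φ : ℝ → ℝ}
    (hg : IntervalIntegrable g volume 0 T) (hφ : ContDiff ℝ 1 φ) (h0 : φ 0 = 0) (hφT : φ T = 0) :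
    ∫ t in 0..T, deriv φ t * ∫ x in 0..t, g x = -∫ t in 0..T, φ t * g t := by
  have hac := hg.absolutelyContinuousOnInterval_intervalIntegral (c := 0) left_mem_uIcc
  have hacφ : AbsolutelyContinuousOnInterval φ 0 T :=
    hφ.contDiffOn.absolutelyContinuousOnInterval
  have h := hacφ.integral_mul_deriv_eq_deriv_mul hac
  rw [h0, hφT, zero_mul, zero_mul, sub_zero, zero_sub] at h
  have h1 : ∫ t in 0..T, φ t * g t
      = ∫ t in 0..T, φ t * deriv (fun x => ∫ v in 0..x, g v) t := by
    refine intervalIntegral.integral_congr_ae ?_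
    filter_upwards [hg.ae_hasDerivAt_integral] with x hx hxm
    rw [(hx (uIoc_subset_uIcc hxm) 0 left_mem_uIcc).deriv]
  rw [h1, h, neg_neg]

/-- Apply continuous functionals, which separate points, to reduce to the scalar integration by
parts. -/
theorem integral_deriv_smul_primitive [CompleteSpace X] {T : ℝ} {g : ℝ → X}
    {φ : ℝ → ℝ} (hg : IntervalIntegrable g volume 0 T) (hφ : ContDiff ℝ 1 φ) (h0 : φ 0 = 0)
    (hφT : φ T = 0) :
    ∫ t in 0..T, deriv φ t • ∫ x in 0..t, g x = -∫ t in 0..T, φ t • g t := by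
  have hcont : ContinuousOn (fun t => ∫ x in 0..t, g x) (uIcc 0 T) :=
    intervalIntegral.continuousOn_primitive_interval' hg left_mem_uIcc
  have hi1 : IntervalIntegrable (fun t => deriv φ t • ∫ x in 0..t, g x) volume 0 T :=
    ((hφ.continuous_deriv le_rfl).continuousOn.smul hcont).intervalIntegrable
  have hi2 : IntervalIntegrable (fun t => φ t • g t) volume 0 T :=
    hg.continuousOn_smul hφ.continuous.continuousOn
  refine (SeparatingDual.eq_iff_forall_dual_eq (R := ℝ)).2 fun l => ?_
  rw [map_neg, ← l.intervalIntegral_comp_comm hi1, ← l.intervalIntegral_comp_comm hi2]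
  simp only [map_smul, smul_eq_mul]
  rw [← integral_deriv_mul_primitive (g := fun x => l (g x))
    ⟨l.integrable_comp hg.1, l.integrable_comp hg.2⟩ hφ h0 hφT]
  refine intervalIntegral.integral_congr fun t ht => ?_
  have hgt : IntervalIntegrable g volume 0 t := by
    refine hg.mono_set ?_
    exact uIcc_subset_uIcc left_mem_uIcc ht
  rw [l.intervalIntegral_comp_comm hgt]

/-- The primitive of `χ` vanishes left of the support trivially, and right of it because the total
integral is zero. -/
theorem exists_test_primitive {T : ℝ} {χ : ℝ → ℝ} (hχ : ContDiff ℝ ((⊤ : ℕ∞) : WithTop ℕ∞) χ)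
    (hc : HasCompactSupport χ) (hs : tsupport χ ⊆ Ioo 0 T) (hT : 0 < T) (h0 : ∫ t, χ t = 0) :
    ∃ φ : ℝ → ℝ, ContDiff ℝ ((⊤ : ℕ∞) : WithTop ℕ∞) φ ∧ HasCompactSupport φ ∧
      tsupport φ ⊆ Ioo 0 T ∧ deriv φ = χ := by
  obtain ⟨a, b, ha, hb, hab⟩ : ∃ a b, 0 < a ∧ b < T ∧ tsupport χ ⊆ Ioo a b := by
    rcases (tsupport χ).eq_empty_or_nonempty with h | h
    · exact ⟨T / 2, T / 2, by linarith, by linarith, by rw [h]; exact empty_subset _⟩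
    · obtain ⟨x, hx, hxl⟩ := hc.isCompact.exists_isLeast h
      obtain ⟨y, hy, hyl⟩ := hc.isCompact.exists_isGreatest h
      refine ⟨x / 2, (y + T) / 2, by linarith [(hs hx).1], by linarith [(hs hy).2], fun z hz => ?_⟩
      have h1 := hxl hz
      have h2 := hyl hz
      exact ⟨by linarith [(hs hx).1], by linarith [(hs hy).2]⟩
  have hz : ∀ x, x ∉ Ioo a b → χ x = 0 := fun x hx => image_eq_zero_of_notMem_tsupport fun h => hx (hab h)
  have hder : ∀ t, HasDerivAt (fun t => ∫ x in a..t, χ x) (χ t) t := fun t =>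
    hχ.continuous.integral_hasStrictDerivAt a t |>.hasDerivAt
  have hderiv : deriv (fun t => ∫ x in a..t, χ x) = χ := funext fun t => (hder t).deriv
  have hout : ∀ t, t ∉ Icc a b → ∫ x in a..t, χ x = 0 := by
    intro t ht
    rw [mem_Icc, not_and_or, not_le, not_le] at ht
    rcases ht with ht | ht
    · rw [intervalIntegral.integral_congr (g := fun _ => (0 : ℝ)), intervalIntegral.integral_zero]
      intro x hx
      rw [uIcc_of_ge ht.le] at hx
      exact hz x fun h => not_lt.2 hx.2 h.1
    · rw [intervalIntegral.integral_eq_integral_of_support_subset, h0]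
      intro x hx
      have := hab (subset_tsupport χ hx)
      exact ⟨this.1, this.2.le.trans ht.le⟩
  have hts : tsupport (fun t => ∫ x in a..t, χ x) ⊆ Icc a b := by
    refine closure_minimal (fun t ht => ?_) isClosed_Icc
    by_contra h
    exact ht (hout t h)
  refine ⟨fun t => ∫ x in a..t, χ x, ?_, ?_, ?_, hderiv⟩
  · rw [contDiff_infty_iff_deriv, hderiv]
    exact ⟨fun t => (hder t).differentiableAt, hχ⟩
  · exact isCompact_Icc.of_isClosed_subset (isClosed_tsupport _) hts
  · exact hts.trans fun t ht => ⟨ha.trans_le ht.1, ht.2.trans_lt hb⟩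

/-- A function whose weak derivative vanishes is constant. -/
theorem IsWeakDeriv.ae_eq_const [CompleteSpace X] {T : ℝ} (hT : 0 < T) {f : ℝ → X}
    (hf : IntegrableOn f (Ioo 0 T)) (h : IsWeakDeriv T f 0) :
    ∃ c, ∀ᵐ t ∂volume.restrict (Ioo 0 T), f t = c := by
  have hsm : ∀ {ψ : ℝ → ℝ}, ContDiff ℝ ((⊤ : ℕ∞) : WithTop ℕ∞) ψ → HasCompactSupport ψ →
      IntegrableOn (fun t => ψ t • f t) (Ioo 0 T) := by
    intro ψ hψ hc
    obtain ⟨C, hC⟩ := hc.exists_bound_of_continuous hψ.continuous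
    exact Integrable.bdd_smul hf C hψ.continuous.aestronglyMeasurable (Eventually.of_forall hC)
  let b : ContDiffBump (T / 2 : ℝ) := ⟨T / 8, T / 4, by linarith, by linarith⟩
  set ψ₀ : ℝ → ℝ := b.normed volume
  have hψ₀ : ContDiff ℝ ((⊤ : ℕ∞) : WithTop ℕ∞) ψ₀ := b.contDiff_normed
  have hc₀ : HasCompactSupport ψ₀ := b.hasCompactSupport_normed
  have hs₀ : tsupport ψ₀ ⊆ Ioo 0 T := by
    rw [b.tsupport_normed_eq, Real.closedBall_eq_Icc]
    intro x hx
    have h1 : b.rOut = T / 4 := rfl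
    rw [h1] at hx
    exact ⟨by linarith [hx.1], by linarith [hx.2]⟩
  have hi₀ : ∫ t, ψ₀ t = 1 := b.integral_normed
  refine ⟨∫ t in Ioo 0 T, ψ₀ t • f t, ?_⟩
  set c := ∫ t in Ioo 0 T, ψ₀ t • f t
  rw [ae_restrict_iff' measurableSet_Ioo]
  have hloc : LocallyIntegrableOn (fun t => f t - c) (Ioo 0 T) volume :=
    (hf.sub (integrableOn_const (by simp))).locallyIntegrableOn
  have := isOpen_Ioo.ae_eq_zero_of_integral_contDiff_smul_eq_zero hloc fun ψ hψ hc hs => ?_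
  · filter_upwards [this] with t ht htm
    exact sub_eq_zero.1 (ht htm)
  set I := ∫ t, ψ t
  have hint : ∀ {ψ : ℝ → ℝ}, ContDiff ℝ ((⊤ : ℕ∞) : WithTop ℕ∞) ψ → HasCompactSupport ψ →
      Integrable ψ := fun hψ hc => hψ.continuous.integrable_of_hasCompactSupport hc
  -- Subtracting the multiple `(∫ ψ) ψ₀` of the normalized bump makes the integral zero, so the
  -- hypothesis on `f` applies and gives `∫ ψ f = (∫ ψ) c`.
  obtain ⟨φ, hφ, hφc, hφs, hφd⟩ := exists_test_primitive (T := T) (χ := fun t => ψ t - I * ψ₀ t)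
    (hψ.sub (contDiff_const.mul hψ₀)) (hc.sub hc₀.mul_left)
    ((tsupport_sub ψ _).trans (union_subset hs ((tsupport_mul_subset_right).trans hs₀))) hT
    (by rw [integral_sub (hint hψ hc) ((hint hψ₀ hc₀).const_mul I), integral_const_mul, hi₀]; simp [I])
  have hw := h φ hφ hφc hφs
  rw [hφd] at hw
  simp only [Pi.zero_apply, smul_zero, integral_zero, neg_zero, sub_smul, mul_smul] at hw
  have hI₀ : IntegrableOn (fun t => I • ψ₀ t • f t) (Ioo 0 T) := (hsm hψ₀ hc₀).smul I
  rw [integral_sub (hsm hψ hc) hI₀, integral_smul] at hw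
  have hsupp : ∫ t, ψ t • (f t - c) = ∫ t in Ioo 0 T, ψ t • (f t - c) := by
    rw [setIntegral_eq_integral_of_forall_compl_eq_zero]
    intro x hx
    rw [image_eq_zero_of_notMem_tsupport fun h => hx (hs h), zero_smul]
  have hI : ∫ t in Ioo 0 T, ψ t = I := by
    rw [setIntegral_eq_integral_of_forall_compl_eq_zero]
    intro x hx
    exact image_eq_zero_of_notMem_tsupport fun h => hx (hs h)
  rw [hsupp]
  simp only [smul_sub]
  rw [integral_sub (hsm hψ hc) ((hint hψ hc).integrableOn.smul_const c), integral_smul_const, hI]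
  exact hw

/-- Subtract from `f` the primitive of `g`; integration by parts shows that the difference has zero
weak derivative. -/
theorem IsWeakDeriv.ae_eq_primitive [CompleteSpace X] {T : ℝ} (hT : 0 < T) {f g : ℝ → X}
    (hf : IntegrableOn f (Ioo 0 T)) (hg : IntegrableOn g (Ioo 0 T)) (h : IsWeakDeriv T f g) :
    ∃ c, ∀ᵐ t ∂volume.restrict (Ioo 0 T), f t = c + ∫ x in 0..t, g x := by
  have hgi : IntervalIntegrable g volume 0 T := by
    rwa [intervalIntegrable_iff_integrableOn_Ioo_of_le hT.le]
  have hcont : ContinuousOn (fun t => ∫ x in 0..t, g x) (uIcc 0 T) :=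
    intervalIntegral.continuousOn_primitive_interval' hgi left_mem_uIcc
  have hGi : IntegrableOn (fun t => ∫ x in 0..t, g x) (Ioo 0 T) := by
    rw [← intervalIntegrable_iff_integrableOn_Ioo_of_le hT.le]
    exact hcont.intervalIntegrable
  obtain ⟨c, hc⟩ := IsWeakDeriv.ae_eq_const hT (hf.sub hGi) (fun φ hφ hφc hφs => by
    have hd : ContDiff ℝ 1 φ := hφ.of_le (by exact_mod_cast le_top)
    have hdi : ∀ {q : ℝ → X}, IntegrableOn q (Ioo 0 T) →
        IntegrableOn (fun t => deriv φ t • q t) (Ioo 0 T) := by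
      intro q hq
      obtain ⟨C, hC⟩ := hφc.deriv.exists_bound_of_continuous (hd.continuous_deriv le_rfl)
      exact Integrable.bdd_smul hq C (hd.continuous_deriv le_rfl).aestronglyMeasurable
        (Eventually.of_forall hC)
    have hz : ∀ x, x ∉ Ioo 0 T → φ x = 0 := fun x hx =>
      image_eq_zero_of_notMem_tsupport fun h => hx (hφs h)
    have h1 := integral_deriv_smul_primitive hgi hd (hz 0 (by simp)) (hz T (by simp))
    rw [intervalIntegral.integral_of_le hT.le, intervalIntegral.integral_of_le hT.le,
      integral_Ioc_eq_integral_Ioo, integral_Ioc_eq_integral_Ioo] at h1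
    have h2 := h φ hφ hφc hφs
    simp only [Pi.sub_apply, Pi.zero_apply, smul_zero, integral_zero, neg_zero, smul_sub]
    rw [integral_sub (hdi hf) (hdi hGi), h1, h2, sub_self])
  refine ⟨c, ?_⟩
  filter_upwards [hc] with t ht
  rw [← ht]
  simp

/-- Functions in `H^k` are iterated primitives. -/
theorem MemSobolev.exists_primitive [CompleteSpace X] {T : ℝ} (hT : 0 < T) {k : ℕ} {f : ℝ → X}
    (hf : MemSobolev k T f) :
    ∃ h : ℕ → ℝ → X, f =ᵐ[volume.restrict (Ioo 0 T)] h 0 ∧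
      MemLp (h k) 2 (volume.restrict (Ioo 0 T)) ∧
      (∀ j ≤ k, IntervalIntegrable (h j) volume 0 T) ∧
      ∀ j < k, ∀ s ∈ Icc 0 T, ∀ t ∈ Icc 0 T, h j t - h j s = ∫ x in s..t, h (j + 1) x := by
  obtain ⟨g, hg0, hgL, hgw⟩ := hf
  have hgi : ∀ j ≤ k, IntegrableOn (g j) (Ioo 0 T) := fun j hj =>
    (hgL j hj).integrable (by norm_num)
  have hgI : ∀ j ≤ k, IntervalIntegrable (g j) volume 0 T := fun j hj => by
    rw [intervalIntegrable_iff_integrableOn_Ioo_of_le hT.le]; exact hgi j hj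
  have hex : ∀ j, ∃ c, j < k → ∀ᵐ t ∂volume.restrict (Ioo 0 T), g j t = c + ∫ x in 0..t, g (j + 1) x := by
    intro j
    by_cases hj : j < k
    · obtain ⟨c, hc⟩ := (hgw j hj).ae_eq_primitive hT (hgi j hj.le) (hgi (j + 1) hj)
      exact ⟨c, fun _ => hc⟩
    · exact ⟨0, fun h => absurd h hj⟩
  choose c hc using hex
  -- Orders below `k` are replaced by their continuous representatives; the top order has only an
  -- `L²` class and is kept.
  set h : ℕ → ℝ → X := fun j => if j < k then fun t => c j + ∫ x in 0..t, g (j + 1) x else g j with hh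
  have hae : ∀ j, g j =ᵐ[volume.restrict (Ioo 0 T)] h j := by
    intro j
    simp only [hh]
    split_ifs with hj
    · exact hc j hj
    · exact Filter.EventuallyEq.rfl
  have hae' : ∀ j, g j =ᵐ[volume.restrict (Ioc 0 T)] h j := fun j => by
    rw [← restrict_Ioo_eq_restrict_Ioc]; exact hae j
  have hhI : ∀ j ≤ k, IntervalIntegrable (h j) volume 0 T := fun j hj =>
    (hgI j hj).congr_ae (by rw [uIoc_of_le hT.le]; exact hae' j)
  refine ⟨h, hg0 ▸ hae 0, ?_, hhI, ?_⟩
  · exact (memLp_congr_ae (hae k)).1 (hgL k le_rfl)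
  · intro j hj s hs t ht
    have h1 : h j = fun t => c j + ∫ x in 0..t, g (j + 1) x := by simp only [hh, if_pos hj]
    have hsub : ∀ {s t : ℝ}, s ∈ Icc 0 T → t ∈ Icc 0 T →
        IntervalIntegrable (g (j + 1)) volume s t := fun hs ht =>
      (hgI (j + 1) hj).mono_set (by rw [uIcc_of_le hT.le]; exact uIcc_subset_Icc hs ht)
    have h0 : (0 : ℝ) ∈ Icc 0 T := ⟨le_rfl, hT.le⟩
    rw [h1, add_sub_add_left_eq_sub,
      intervalIntegral.integral_interval_sub_left (hsub h0 ht) (hsub h0 hs)]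
    refine intervalIntegral.integral_congr_ae ?_
    have h2 := hae' (j + 1)
    rw [Filter.EventuallyEq, ae_restrict_iff' measurableSet_Ioc] at h2
    filter_upwards [h2] with x hx hxm
    refine hx ?_
    have h3 := mem_uIoc.1 hxm
    rcases h3 with h3 | h3
    · exact ⟨hs.1.trans_lt h3.1, h3.2.trans ht.2⟩
    · exact ⟨ht.1.trans_lt h3.1, h3.2.trans hs.2⟩

theorem MemSobolev.map {Y : Type*} [NormedAddCommGroup Y] [NormedSpace ℝ Y] [CompleteSpace X]
    [CompleteSpace Y] {T : ℝ} {k : ℕ} {f : ℝ → X} (hf : MemSobolev k T f) (l : X →L[ℝ] Y) :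
    MemSobolev k T fun t => l (f t) := by
  obtain ⟨g, rfl, hgL, hgw⟩ := hf
  refine ⟨fun j t => l (g j t), rfl, fun j hj => l.comp_memLp' (hgL j hj), ?_⟩
  intro j hj φ hφ hφc hφs
  have hint : ∀ {ψ : ℝ → ℝ} {q : ℝ → X}, Continuous ψ → HasCompactSupport ψ →
      MemLp q 2 (volume.restrict (Ioo 0 T)) → IntegrableOn (fun t => ψ t • q t) (Ioo 0 T) := by
    intro ψ q hψ hc hq
    obtain ⟨C, hC⟩ := hc.exists_bound_of_continuous hψ
    exact Integrable.bdd_smul (hq.integrable (by norm_num)) C hψ.aestronglyMeasurable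
      (Eventually.of_forall hC)
  have hd : ContDiff ℝ 1 φ := hφ.of_le (by exact_mod_cast le_top)
  have h1 := l.integral_comp_comm (hint (hd.continuous_deriv le_rfl) hφc.deriv (hgL j hj.le))
  have h2 := l.integral_comp_comm (hint hφ.continuous hφc (hgL (j + 1) hj))
  simp only [map_smul] at h1 h2
  rw [h1, h2, hgw j hj φ hφ hφc hφs, map_neg]

end WeakDeriv

/-! ### Polynomial approximation and Lagrange interpolation -/

section Interpolation

variable {X : Type*} [NormedAddCommGroup X] [NormedSpace ℝ X]

/-- Induction on `k`: approximate `h 1` by a polynomial and integrate it, starting from the value `h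
0 a`. Each integration contributes one factor `b - a`. -/
theorem exists_polynomial_norm_sub_le [CompleteSpace X] {a b : ℝ} (hab : a ≤ b) {k : ℕ}
    {h : ℕ → ℝ → X} (hi : ∀ j ≤ k + 1, IntervalIntegrable (h j) volume a b)
    (hh : ∀ j ≤ k, ∀ x ∈ Icc a b, h j x - h j a = ∫ y in a..x, h (j + 1) y) :
    ∃ c : ℕ → X, ∀ x ∈ Icc a b, ‖h 0 x - ∑ i ∈ Finset.range (k + 1), (x - a) ^ i • c i‖
      ≤ (b - a) ^ k * ∫ y in a..b, ‖h (k + 1) y‖ := by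
  induction k generalizing h with
  | zero =>
    refine ⟨fun _ => h 0 a, fun x hx => ?_⟩
    simp only [zero_add, Finset.range_one, Finset.sum_singleton, pow_zero, one_smul, one_mul]
    rw [hh 0 le_rfl x hx]
    refine (intervalIntegral.norm_integral_le_integral_norm hx.1).trans ?_
    exact intervalIntegral.integral_mono_interval le_rfl hx.1 hx.2
      (Eventually.of_forall fun _ => norm_nonneg _) (hi 1 le_rfl).norm
  | succ k ih =>
    obtain ⟨c, hc⟩ := ih (h := fun j => h (j + 1)) (fun j hj => hi (j + 1) (by omega))
      (fun j hj => hh (j + 1) (by omega))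
    set M := (b - a) ^ k * ∫ y in a..b, ‖h (k + 1 + 1) y‖
    refine ⟨fun i => if i = 0 then h 0 a else (i : ℝ)⁻¹ • c (i - 1), fun x hx => ?_⟩
    set q : ℝ → X := fun y => ∑ i ∈ Finset.range (k + 1), (y - a) ^ i • c i
    have hq : ∫ y in a..x, q y
        = ∑ i ∈ Finset.range (k + 1), (x - a) ^ (i + 1) • ((i + 1 : ℕ) : ℝ)⁻¹ • c i := by
      rw [intervalIntegral.integral_finsetSum]
      · refine Finset.sum_congr rfl fun i _ => ?_
        rw [intervalIntegral.integral_smul_const, intervalIntegral.integral_comp_sub_right (fun y => y ^ i),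
          integral_pow, smul_smul, sub_self, zero_pow (Nat.succ_ne_zero i), sub_zero, div_eq_mul_inv]
        push_cast
        rfl
      · intro i _
        exact Continuous.intervalIntegrable (by fun_prop) _ _
    have hqi : IntervalIntegrable q volume a x := Continuous.intervalIntegrable (by fun_prop) _ _
    have h1i : IntervalIntegrable (h 1) volume a x :=
      (hi 1 (by omega)).mono_set (by rw [uIcc_of_le hab, uIcc_of_le hx.1]; exact Icc_subset_Icc_right hx.2)
    have h1 : h 0 x - ∑ i ∈ Finset.range (k + 1 + 1), (x - a) ^ i •
          (if i = 0 then h 0 a else (i : ℝ)⁻¹ • c (i - 1)) = ∫ y in a..x, (h 1 y - q y) := by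
      rw [Finset.sum_range_succ', intervalIntegral.integral_sub h1i hqi, hq, ← hh 0 (by omega) x hx]
      simp only [Nat.add_sub_cancel, Nat.succ_ne_zero, if_false, if_true, pow_zero, one_smul]
      abel
    rw [h1]
    have hM : ∀ y ∈ uIoc a x, ‖h 1 y - q y‖ ≤ M := by
      intro y hy
      rw [uIoc_of_le hx.1] at hy
      exact hc y ⟨hy.1.le, hy.2.trans hx.2⟩
    have hM0 : 0 ≤ M := mul_nonneg (pow_nonneg (sub_nonneg.2 hab) _)
      (intervalIntegral.integral_nonneg hab fun _ _ => norm_nonneg _)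
    refine (intervalIntegral.norm_integral_le_of_norm_le_const hM).trans ?_
    rw [abs_of_nonneg (sub_nonneg.2 hx.1)]
    calc M * (x - a) ≤ M * (b - a) := by gcongr; exact hx.2
      _ = _ := by simp only [M]; ring

/-! ### Lagrange interpolation at variable nodes. -/

theorem sum_stepSize (t : ℕ → ℝ) {n m : ℕ} (hm : m ≤ n) :
    ∑ j ∈ Finset.Icc 1 m, stepSize t (n - j) = t n - t (n - m) := by
  induction m with
  | zero => simp
  | succ m ih =>
    rw [Finset.sum_Icc_succ_top (by omega), ih (by omega), stepSize,
      show n - (m + 1) + 1 = n - m by omega]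
    ring

theorem lagrangeBasis_eq_eval (t : ℕ → ℝ) {k n i : ℕ} (hk : k ≤ n + 1) (hi : i < k) (s : ℝ) :
    lagrangeBasis t k n i s
      = (Lagrange.basis (Finset.range k) (fun m => t (n - m)) i).eval (s + t n) := by
  rw [lagrangeBasis, Lagrange.basis, Polynomial.eval_prod]
  refine Finset.prod_congr rfl fun m hm => ?_
  have hm' := Finset.mem_range.1 (Finset.mem_of_mem_erase hm)
  rw [sum_stepSize t (by omega), sum_stepSize t (by omega), Lagrange.basisDivisor]
  simp only [Polynomial.eval_mul, Polynomial.eval_C, Polynomial.eval_sub, Polynomial.eval_X]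
  rw [div_eq_inv_mul]
  congr 1
  · congr 1; ring
  · ring

theorem continuous_lagrangeBasis (t : ℕ → ℝ) (k n i : ℕ) : Continuous (lagrangeBasis t k n i) := by
  unfold lagrangeBasis
  fun_prop

theorem node_lt {t : ℕ → ℝ} {N : ℕ} (ht : ∀ n < N, t n < t (n + 1)) {i j : ℕ} (hij : i < j)
    (hj : j ≤ N) : t i < t j := by
  induction j, hij using Nat.le_induction with
  | base => exact ht i hj
  | succ j _ ih => exact (ih (by omega)).trans (ht j hj)

theorem node_le {t : ℕ → ℝ} {N : ℕ} (ht : ∀ n < N, t n < t (n + 1)) {i j : ℕ} (hij : i ≤ j)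
    (hj : j ≤ N) : t i ≤ t j := by
  rcases hij.eq_or_lt with rfl | h
  · exact le_rfl
  · exact (node_lt ht h hj).le

/-- Interpolation at `k` distinct nodes reproduces polynomials of degree below `k`; the shifted
monomials match the Taylor-type approximation at the oldest node. -/
theorem sum_lagrangeBasis_mul_pow {t : ℕ → ℝ} {N k n : ℕ} (ht : ∀ n < N, t n < t (n + 1))
    (hn : n < N) (hk : k ≤ n + 1) (a s : ℝ) {j : ℕ} (hj : j < k) :
    ∑ i ∈ Finset.range k, lagrangeBasis t k n i (s - t n) * (t (n - i) - a) ^ j = (s - a) ^ j := by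
  have hinj : Set.InjOn (fun m => t (n - m)) (Finset.range k : Set ℕ) := by
    intro i hi i' hi' hii
    have h1 : i < k := by simpa using hi
    have h2 : i' < k := by simpa using hi'
    simp only at hii
    by_contra hne
    rcases lt_or_gt_of_ne hne with h | h
    · exact absurd hii (node_lt ht (by omega : n - i' < n - i) (by omega)).ne'
    · exact absurd hii (node_lt ht (by omega : n - i < n - i') (by omega)).ne
  have hdeg : ((Polynomial.X - Polynomial.C a : Polynomial ℝ) ^ j).degree
      < (Finset.range k).card := by
    rw [Polynomial.degree_pow, Polynomial.degree_X_sub_C, Finset.card_range, nsmul_eq_mul, mul_one]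
    exact_mod_cast hj
  have h := congrArg (Polynomial.eval s) (Lagrange.eq_interpolate hinj hdeg)
  rw [Lagrange.interpolate_apply, Polynomial.eval_finsetSum] at h
  simp only [Polynomial.eval_mul, Polynomial.eval_C, Polynomial.eval_pow, Polynomial.eval_sub,
    Polynomial.eval_X] at h
  rw [h]
  refine Finset.sum_congr rfl fun i hi => ?_
  rw [lagrangeBasis_eq_eval t hk (Finset.mem_range.1 hi), sub_add_cancel, mul_comm]

theorem node_sub_le {t : ℕ → ℝ} {n m : ℕ} (hm : m ≤ n) {R : ℝ}
    (hR : ∀ l ≤ m, stepSize t (n - l) ≤ R) : t (n + 1) - t (n - m) ≤ (m + 1) * R := by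
  induction m with
  | zero => have := hR 0 le_rfl; simpa [stepSize] using this
  | succ m ih =>
    have h1 := ih (by omega) fun l hl => hR l (by omega)
    have h2 := hR (m + 1) le_rfl
    rw [stepSize, show n - (m + 1) + 1 = n - m by omega] at h2
    push_cast
    linarith

/-- Each of the `k - 1` factors is at most `k r`: its numerator spans at most `k` steps, and its
denominator spans at least one, all of comparable size. -/
theorem abs_lagrangeBasis_le {t : ℕ → ℝ} {N k n : ℕ} {r : ℝ} (ht : ∀ n < N, t n < t (n + 1))
    (hr : ∀ n < N, ∀ m < N, |(n : ℤ) - m| < k → stepSize t n / stepSize t m ≤ r)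
    (hn : n < N) (hk : k ≤ n + 1) {i : ℕ} (hi : i < k) {s : ℝ} (hs : s ∈ Icc (t n) (t (n + 1))) :
    |lagrangeBasis t k n i (s - t n)| ≤ (k * r) ^ (k - 1) := by
  have hpos : ∀ l < N, 0 < stepSize t l := fun l hl => sub_pos.2 (ht l hl)
  rw [lagrangeBasis, Finset.abs_prod]
  have hcard : ((Finset.range k).erase i).card = k - 1 := by
    rw [Finset.card_erase_of_mem (Finset.mem_range.2 hi), Finset.card_range]
  rw [← hcard, ← Finset.prod_const]
  refine Finset.prod_le_prod (fun _ _ => abs_nonneg _) fun m hm => ?_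
  have hm' : m < k := Finset.mem_range.1 (Finset.mem_of_mem_erase hm)
  have hne : m ≠ i := Finset.ne_of_mem_erase hm
  rw [sum_stepSize t (by omega), sum_stepSize t (by omega), abs_div]
  -- The step that leaves the older of the two nodes `t (n - i)`, `t (n - m)` lies between them, so
  -- its length `σ` bounds the denominator from below.
  set j := max i m
  have hj1 : 1 ≤ j := by omega
  have hjk : j < k := by omega
  have hσ := hpos (n - j) (by omega)
  set σ := stepSize t (n - j) with hσdef
  have hden : σ ≤ |t n - t (n - m) - (t n - t (n - i))| := by
    rw [show t n - t (n - m) - (t n - t (n - i)) = t (n - i) - t (n - m) by ring]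
    rcases lt_or_gt_of_ne hne with h | h
    · have hji : j = i := by omega
      rw [abs_sub_comm]
      refine le_trans ?_ (le_abs_self _)
      rw [hσdef, stepSize, hji]
      have := node_le ht (show n - i + 1 ≤ n - m by omega) (by omega)
      linarith
    · have hjm : j = m := by omega
      refine le_trans ?_ (le_abs_self _)
      rw [hσdef, stepSize, hjm]
      have := node_le ht (show n - m + 1 ≤ n - i by omega) (by omega)
      linarith
  have hR : ∀ l < k, stepSize t (n - l) ≤ r * σ := fun l hl => by
    rw [← div_le_iff₀ hσ]
    exact hr _ (by omega) _ (by omega) (by rw [abs_lt]; omega)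
  have hrσ : 0 ≤ r * σ := (hpos n hn).le.trans (hR 0 (by omega))
  have hnum : |t n - t (n - m) + (s - t n)| ≤ k * (r * σ) := by
    have h1 : t (n - m) ≤ t n := node_le ht (by omega) hn.le
    rw [abs_of_nonneg (by linarith [hs.1])]
    have h2 := node_sub_le (t := t) (show m ≤ n by omega) (R := r * σ) fun l hl => hR l (by omega)
    have h3 : ((m : ℝ) + 1) ≤ k := by exact_mod_cast hm'
    have h4 := mul_le_mul_of_nonneg_right h3 hrσ
    linarith [hs.2]
  have hden0 : 0 < |t n - t (n - m) - (t n - t (n - i))| := hσ.trans_le hden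
  rw [div_le_iff₀ hden0]
  have hr0 : 0 ≤ r := nonneg_of_mul_nonneg_left hrσ hσ
  calc _ ≤ k * (r * σ) := hnum
    _ = k * r * σ := by ring
    _ ≤ _ := by gcongr

/-- Interpolation is exact on the approximating polynomial `q`, so the error equals that of `h 0 -
q`, controlled by the approximation bound and the size of the basis. -/
theorem norm_sub_lagrange_le [CompleteSpace X] {t : ℕ → ℝ} {N k n : ℕ} {r : ℝ}
    (ht : ∀ n < N, t n < t (n + 1)) (hr0 : 0 ≤ r)
    (hr : ∀ n < N, ∀ m < N, |(n : ℤ) - m| < (k + 1 : ℕ) → stepSize t n / stepSize t m ≤ r)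
    (hn : n < N) (hk : k ≤ n) {h : ℕ → ℝ → X}
    (hi : ∀ j ≤ k + 1, IntervalIntegrable (h j) volume (t (n - k)) (t (n + 1)))
    (hh : ∀ j ≤ k, ∀ x ∈ Icc (t (n - k)) (t (n + 1)),
      h j x - h j (t (n - k)) = ∫ y in t (n - k)..x, h (j + 1) y)
    {s : ℝ} (hs : s ∈ Icc (t n) (t (n + 1))) :
    ‖h 0 s - ∑ i ∈ Finset.range (k + 1), lagrangeBasis t (k + 1) n i (s - t n) • h 0 (t (n - i))‖
      ≤ (1 + (k + 1) * ((k + 1 : ℕ) * r) ^ k) * ((t (n + 1) - t (n - k)) ^ k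
        * ∫ y in t (n - k)..t (n + 1), ‖h (k + 1) y‖) := by
  have hab : t (n - k) ≤ t (n + 1) := node_le ht (by omega) hn
  obtain ⟨c, hc⟩ := exists_polynomial_norm_sub_le hab hi hh
  set M := (t (n + 1) - t (n - k)) ^ k * ∫ y in t (n - k)..t (n + 1), ‖h (k + 1) y‖
  set a := t (n - k)
  set q : ℝ → X := fun x => ∑ j ∈ Finset.range (k + 1), (x - a) ^ j • c j with hq
  set l : ℕ → ℝ := fun i => lagrangeBasis t (k + 1) n i (s - t n) with hl
  have hM0 : 0 ≤ M := mul_nonneg (pow_nonneg (sub_nonneg.2 hab) _)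
    (intervalIntegral.integral_nonneg hab fun _ _ => norm_nonneg _)
  have hqs : ∑ i ∈ Finset.range (k + 1), l i • q (t (n - i)) = q s := by
    simp only [hq, Finset.smul_sum, smul_smul]
    rw [Finset.sum_comm]
    refine Finset.sum_congr rfl fun j hj => ?_
    rw [← Finset.sum_smul, sum_lagrangeBasis_mul_pow ht hn (by omega) a s (Finset.mem_range.1 hj)]
  have h1 : h 0 s - ∑ i ∈ Finset.range (k + 1), l i • h 0 (t (n - i))
      = (h 0 s - q s) - ∑ i ∈ Finset.range (k + 1), l i • (h 0 (t (n - i)) - q (t (n - i))) := by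
    simp only [smul_sub, Finset.sum_sub_distrib]
    rw [hqs]
    abel
  have hsm : s ∈ Icc a (t (n + 1)) := ⟨(node_le ht (by omega) hn.le).trans hs.1, hs.2⟩
  change ‖h 0 s - ∑ i ∈ Finset.range (k + 1), l i • h 0 (t (n - i))‖ ≤ _
  rw [h1]
  refine (norm_sub_le _ _).trans ?_
  have h2 : ‖∑ i ∈ Finset.range (k + 1), l i • (h 0 (t (n - i)) - q (t (n - i)))‖
      ≤ ∑ i ∈ Finset.range (k + 1), ((k + 1 : ℕ) * r) ^ k * M := by
    refine norm_sum_le_of_le _ fun i hi => ?_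
    have hik := Finset.mem_range.1 hi
    rw [norm_smul, Real.norm_eq_abs]
    gcongr
    · exact abs_lagrangeBasis_le ht hr hn (by omega) hik hs
    · exact hc _ ⟨node_le ht (by omega) (by omega), node_le ht (by omega) hn⟩
  rw [Finset.sum_const, Finset.card_range, nsmul_eq_mul] at h2
  have h3 := hc s hsm
  calc _ ≤ M + ((k + 1 : ℕ) : ℝ) * (((k + 1 : ℕ) * r) ^ k * M) := add_le_add h3 h2
    _ = _ := by push_cast; ring

end Interpolation

/-! ### Everywhere versions of almost everywhere identities -/

theorem intervalIntegral_eq_sub_of_hasDerivWithinAt {a b : ℝ} {f c : ℝ → ℝ}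
    (hf : ∀ x ∈ Icc a b, HasDerivWithinAt f (c x) (Icc a b) x) (hc : IntervalIntegrable c volume a b)
    {s t : ℝ} (hs : s ∈ Icc a b) (ht : t ∈ Icc a b) (hst : s ≤ t) :
    ∫ x in s..t, c x = f t - f s := by
  have hsub : Icc s t ⊆ Icc a b := Icc_subset_Icc hs.1 ht.2
  refine intervalIntegral.integral_eq_sub_of_hasDerivAt_of_le hst
    (fun x hx => ((hf x (hsub hx)).continuousWithinAt).mono hsub) (fun x hx => ?_) ?_
  · exact (hf x (hsub (Ioo_subset_Icc_self hx))).hasDerivAt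
      (Icc_mem_nhds (hs.1.trans_lt hx.1) (hx.2.trans_le ht.2))
  · refine hc.mono_set ?_
    rw [uIcc_of_le hst, uIcc_of_le (hs.1.trans hs.2)]
    exact hsub

/-- A derivative that is almost everywhere equal to a continuous function is equal to it. -/
theorem eq_of_hasDerivWithinAt_of_ae_eq {T : ℝ} (hT : 0 < T) {f g c : ℝ → ℝ}
    (hf : ∀ t ∈ Icc 0 T, HasDerivWithinAt f (g t) (Icc 0 T) t) (hc : ContinuousOn c (Icc 0 T))
    (hae : g =ᵐ[volume.restrict (Ioo 0 T)] c) : ∀ t ∈ Icc 0 T, g t = c t := by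
  have h0 : (0 : ℝ) ∈ Icc 0 T := ⟨le_rfl, hT.le⟩
  have hae' : g =ᵐ[volume.restrict (Ioc 0 T)] c := by rwa [← restrict_Ioo_eq_restrict_Ioc]
  have hci : IntervalIntegrable c volume 0 T := by
    refine ContinuousOn.intervalIntegrable ?_
    rwa [uIcc_of_le hT.le]
  have hgi : IntervalIntegrable g volume 0 T :=
    hci.congr_ae (by rw [uIoc_of_le hT.le]; exact hae'.symm)
  -- Extending `c` continuously to the whole line makes the primitive differentiable also at the
  -- endpoints; uniqueness of derivatives within `Icc 0 T` then compares the two.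
  set c' : ℝ → ℝ := IccExtend hT.le ((Icc 0 T).domRestrict c)
  have hc' : Continuous c' := (continuousOn_iff_continuous_domRestrict.1 hc).Icc_extend'
  have hcc : ∀ x ∈ Icc 0 T, c' x = c x := fun x hx => by
    simp only [c', IccExtend_of_mem _ _ hx, domRestrict_apply]
  have hfe : ∀ t ∈ Icc 0 T, f t = f 0 + ∫ x in 0..t, c' x := by
    intro t ht
    have h1 := intervalIntegral_eq_sub_of_hasDerivWithinAt hf hgi h0 ht ht.1
    have h2 : ∫ x in 0..t, g x = ∫ x in 0..t, c' x := by
      refine intervalIntegral.integral_congr_ae ?_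
      rw [Filter.EventuallyEq, ae_restrict_iff' measurableSet_Ioc] at hae'
      filter_upwards [hae'] with x hx hxm
      rw [uIoc_of_le ht.1] at hxm
      rw [hx ⟨hxm.1, hxm.2.trans ht.2⟩, hcc x ⟨hxm.1.le, hxm.2.trans ht.2⟩]
    rw [← h2, h1]; ring
  intro t ht
  have h1 : HasDerivWithinAt f (c' t) (Icc 0 T) t :=
    ((hc'.integral_hasStrictDerivAt 0 t).hasDerivAt.const_add (f 0)).hasDerivWithinAt.congr hfe (hfe t ht)
  rw [← hcc t ht]
  exact ((uniqueDiffOn_Icc hT) t ht).eq_deriv _ (hf t ht) h1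

theorem continuousOn_of_sub_eq_integral {X : Type*} [NormedAddCommGroup X] [NormedSpace ℝ X]
    {T : ℝ} (hT : 0 ≤ T) {f g : ℝ → X} (hg : IntervalIntegrable g volume 0 T)
    (h : ∀ s ∈ Icc 0 T, ∀ t ∈ Icc 0 T, f t - f s = ∫ x in s..t, g x) :
    ContinuousOn f (Icc 0 T) := by
  have h1 : ContinuousOn (fun t => f 0 + ∫ x in 0..t, g x) (Icc 0 T) := by
    have := intervalIntegral.continuousOn_primitive_interval' hg left_mem_uIcc
    rw [uIcc_of_le hT] at this
    exact continuousOn_const.add this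
  refine h1.congr fun t ht => ?_
  simp only
  rw [← h 0 ⟨le_rfl, hT⟩ t ht]
  abel

namespace PosDefOp

variable {H : Type*} [NormedAddCommGroup H] [InnerProductSpace ℝ H] [CompleteSpace H]
  (L : PosDefOp H)

/-! ### The equations tested against the range of `L^{-m}` -/

/-- Vectors `L^{-m} h` with `m` large lie in every domain the two weak formulations require, and on
them each term becomes a bounded operator applied to `h`. -/
theorem exists_test {β m : ℝ} (hβ : 0 ≤ β) (hm : β / 2 ≤ m) (hm1 : 1 ≤ m) (h : H) :
    ∃ (φ : L.V β) (hφ : L.toH φ ∈ L.op.domain), L.toH φ = L.invPow m h ∧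
      L.op ⟨L.toH φ, hφ⟩ = L.invPow (m - 1) h ∧
      (∀ R : L.VDual β, R φ = inner ℝ (L.rep hβ R) (L.invPow (m - β / 2) h)) ∧
      ∀ p, 0 ≤ p → p ≤ m → ∃ hφ' : L.toH φ ∈ (L.pow p).domain,
        L.pow p ⟨L.toH φ, hφ'⟩ = L.invPow (m - p) h := by
  set φ := (L.isoV hβ).symm (L.invPow (m - β / 2) h)
  have h1 : L.toH φ = L.invPow m h := by
    rw [L.toH_isoV_symm, L.invPow_invPow (by linarith) (by linarith) (q := m) (by ring)]
  have h2 : ∀ p, 0 ≤ p → p ≤ m → L.invPow p (L.invPow (m - p) h) = L.toH φ := fun p hp hpm => by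
    rw [h1, L.invPow_invPow hp (by linarith) (q := m) (by ring)]
  have hop : ∀ x (hx : x ∈ L.op.domain) y, L.inv y = x → L.op ⟨x, hx⟩ = y := by
    rintro x hx y rfl
    exact L.op_inv y
  have h3 : L.inv (L.invPow (m - 1) h) = L.toH φ := by
    rw [← h2 1 zero_le_one hm1, invPow_one]
  refine ⟨φ, h3 ▸ L.inv_mem _, h1, hop _ _ _ h3, fun R => (L.inner_rep hβ R _).symm,
    fun p hp hpm => ?_⟩
  have hmem := (L.mem_pow_domain hp (L.toH φ)).2 ⟨_, h2 p hp hpm⟩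
  exact ⟨hmem, L.pow_apply_eq hp ⟨_, hmem⟩ _ (h2 p hp hpm)⟩

theorem IsSolution.hasDerivWithinAt {L : PosDefOp H} {ε T β γ : ℝ} {F : L.V γ → L.VDual β}
    {u : ℝ → L.V γ} (hu : L.IsSolution ε T F u) (hβ : 0 ≤ β) {m : ℝ} (hm : β / 2 ≤ m)
    (hm1 : 1 ≤ m) {t : ℝ} (ht : t ∈ Icc 0 T) (h : H) :
    HasDerivWithinAt (fun s => inner ℝ (L.toH (u s)) (L.invPow m h))
      (inner ℝ (L.rep hβ (F (u t))) (L.invPow (m - β / 2) h)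
        - ε * inner ℝ (L.toH (u t)) (L.invPow (m - 1) h)) (Icc 0 T) t := by
  obtain ⟨φ, hφ, h1, h2, h3, -⟩ := L.exists_test hβ hm hm1 h
  have := hu t ht φ hφ
  rwa [h2, h3, h1] at this

/-- Along a solution in `H^1(0, T; V^{2p - β})`, the primitive of the weak derivative gives the
values everywhere. -/
theorem IsSolution.exists_primitive {L : PosDefOp H} {ε T β γ p : ℝ} {F : L.V γ → L.VDual β}
    {u : ℝ → L.V γ} (hu : L.IsSolution ε T F u) (hT : 0 < T) (hβ : 0 ≤ β) (hp : 0 ≤ 2 * p - β)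
    {v : ℝ → L.V (2 * p - β)} (hv : ∀ s ∈ Icc 0 T, L.toH (v s) = L.toH (u s))
    (hvS : MemSobolev 1 T v) :
    ∃ V₀ V₁ : ℝ → H, MemLp V₁ 2 (volume.restrict (Ioo 0 T)) ∧ IntervalIntegrable V₁ volume 0 T ∧
      (∀ s ∈ Icc 0 T, ∀ t ∈ Icc 0 T, V₀ t - V₀ s = ∫ x in s..t, V₁ x) ∧
      ∀ t ∈ Icc 0 T, L.toH (u t) = L.invPow (p - β / 2) (V₀ t) := by
  have hcs := L.completeSpace_V hp
  obtain ⟨V, hV0, hV1, hVi, hVp⟩ := MemSobolev.exists_primitive hT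
    (hvS.map ((L.isoV hp).toContinuousLinearEquiv : L.V (2 * p - β) →L[ℝ] H))
  refine ⟨V 0, V 1, hV1, hVi 1 le_rfl, hVp 0 zero_lt_one, ?_⟩
  have hVc : ContinuousOn (V 0) (Icc 0 T) :=
    continuousOn_of_sub_eq_integral hT.le (hVi 1 le_rfl) (hVp 0 zero_lt_one)
  set m : ℝ := β / 2 + 1
  have hm : 0 ≤ m := by positivity
  have key : ∀ h : H, EqOn (fun t => inner ℝ (L.toH (u t)) (L.invPow m h))
      (fun t => inner ℝ (L.invPow (p - β / 2) (V 0 t)) (L.invPow m h)) (Icc 0 T) := by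
    intro h
    -- Both sides are continuous on `[0, T]`, the left one because the weak formulation makes it
    -- differentiable, so agreement a.e. is agreement everywhere.
    refine Measure.eqOn_Icc_of_ae_eq (μ := volume) hT.ne ?_ (fun t ht => ?_) ?_
    · rw [← restrict_Ioo_eq_restrict_Icc]
      filter_upwards [hV0, ae_restrict_mem measurableSet_Ioo] with t ht htm
      rw [← ht, ← hv t (Ioo_subset_Icc_self htm), ← L.invPow_powV hp]
      congr 3
      ring
    · exact (hu.hasDerivWithinAt hβ (by simp [m]) (by simp [m]; positivity) ht h).continuousWithinAt
    · exact ((L.invPow (p - β / 2)).continuous.comp_continuousOn hVc).inner continuousOn_const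
  intro t ht
  exact L.ext_invPow hm fun z => key z ht

/-- Along a continuous solution, a continuous representative of `F(u)` gives the values of `F(u)`
everywhere. -/
theorem IsSolution.rep_eq {L : PosDefOp H} {ε T β γ : ℝ} {F : L.V γ → L.VDual β}
    {u : ℝ → L.V γ} (hu : L.IsSolution ε T F u) (hT : 0 < T) (hβ : 0 ≤ β)
    (huc : ContinuousOn (fun t => L.toH (u t)) (Icc 0 T)) {g : ℝ → H}
    (hgc : ContinuousOn g (Icc 0 T))
    (hg : (fun t => L.rep hβ (F (u t))) =ᵐ[volume.restrict (Ioo 0 T)] g) :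
    ∀ t ∈ Icc 0 T, L.rep hβ (F (u t)) = g t := by
  intro t ht
  refine L.ext_invPow zero_le_one fun h => ?_
  have hm : β / 2 ≤ β / 2 + 1 := by linarith
  -- The choice `m = β/2 + 1` leaves exactly `L⁻¹ h` paired with the representative of `F(u)`, and
  -- those vectors separate points.
  have key := eq_of_hasDerivWithinAt_of_ae_eq hT
    (c := fun t => inner ℝ (g t) (L.invPow (β / 2 + 1 - β / 2) h)
      - ε * inner ℝ (L.toH (u t)) (L.invPow (β / 2 + 1 - 1) h))
    (fun t ht => hu.hasDerivWithinAt hβ hm (by linarith) ht h)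
    ((hgc.inner continuousOn_const).sub (continuousOn_const.mul (huc.inner continuousOn_const)))
    (by filter_upwards [hg] with x hx; rw [← hx]) t ht
  have h1 : β / 2 + 1 - β / 2 = 1 := by ring
  rw [h1] at key
  linarith

theorem IsETDStep.exists_hasDerivWithinAt {L : PosDefOp H} {ε A p τ β γ : ℝ} {k n : ℕ}
    {F : L.V γ → L.VDual β} {t : ℕ → ℝ} {U : ℕ → L.V γ} (h : L.IsETDStep ε A p τ k F t U n)
    (hβ : 0 ≤ β) {m : ℝ} (hm : β / 2 ≤ m) (hm1 : 1 ≤ m) (hp : 0 ≤ p) (hpm : p ≤ m) :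
    ∃ w : ℝ → H, ContinuousOn w (Icc (t n) (t (n + 1))) ∧
      w (t n) = L.toH (U n) ∧ w (t (n + 1)) = L.toH (U (n + 1)) ∧
      ∀ s ∈ Icc (t n) (t (n + 1)), ∀ h : H,
        HasDerivWithinAt
          (fun r => inner ℝ (w r) (L.invPow m h) + A * τ ^ k * inner ℝ (w r) (L.invPow (m - p) h))
          (inner ℝ (∑ i ∈ Finset.range k, lagrangeBasis t k n i (s - t n) • L.rep hβ (F (U (n - i))))
              (L.invPow (m - β / 2) h) - ε * inner ℝ (w s) (L.invPow (m - 1) h))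
          (Icc (t n) (t (n + 1))) s := by
  obtain ⟨w, hwc, hw0, hw1, hw⟩ := h
  refine ⟨w, hwc, hw0, hw1, fun s hs h => ?_⟩
  obtain ⟨φ, hφ, h1, h2, h3, h4⟩ := L.exists_test hβ hm hm1 h
  obtain ⟨hφ', h5⟩ := h4 p hp hpm
  have := hw s hs φ hφ hφ'
  rw [h2, h5, h1] at this
  simp only [h3] at this
  rw [sum_inner]
  simpa only [real_inner_smul_left] using this

/-- The energy estimate for the difference of an exact solution `u` and a solution `w` of the
stabilized equation. -/
theorem eNormV_sub_le {ε A β p a b E : ℝ} (hε : 0 < ε) (hA : 0 ≤ A) (hβ : 0 ≤ β) (hβ1 : β ≤ 1)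
    (hp : β / 2 ≤ p) (hab : a ≤ b) (hE : 0 ≤ E) {m : ℕ} (hm : p + 2 ≤ m)
    {u g V₀ V₁ w g' : ℝ → H} (huc : ContinuousOn u (Icc a b)) (hgc : ContinuousOn g (Icc a b))
    (hu : ∀ x ∈ Icc a b, ∀ h, HasDerivWithinAt (fun s => inner ℝ (u s) (L.invPow m h))
      (inner ℝ (g x) (L.invPow (m - β / 2) h) - ε * inner ℝ (u x) (L.invPow (m - 1) h)) (Icc a b) x)
    (huV : ∀ x ∈ Icc a b, u x = L.invPow (p - β / 2) (V₀ x))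
    (hV : ∀ s ∈ Icc a b, ∀ t ∈ Icc a b, V₀ t - V₀ s = ∫ x in s..t, V₁ x)
    (hV₁ : MemLp V₁ 2 (volume.restrict (Ioc a b)))
    (hwc : ContinuousOn w (Icc a b)) (hgc' : ContinuousOn g' (Icc a b))
    (hw : ∀ x ∈ Icc a b, ∀ h, HasDerivWithinAt
      (fun s => inner ℝ (w s) (L.invPow m h) + A * inner ℝ (w s) (L.invPow (m - p) h))
      (inner ℝ (g' x) (L.invPow (m - β / 2) h) - ε * inner ℝ (w x) (L.invPow (m - 1) h))
      (Icc a b) x)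
    (hinit : L.eNormV (1 - β) (u a - w a) ^ 2
      + ENNReal.ofReal A * L.eNormV (p + (1 - β)) (u a - w a) ^ 2 ≤ ENNReal.ofReal E) :
    L.eNormV (1 - β) (u b - w b) ^ 2
        + ENNReal.ofReal A * L.eNormV (p + (1 - β)) (u b - w b) ^ 2
      ≤ ENNReal.ofReal (E + (2 * ε)⁻¹ * ∫ x in a..b, ‖g x - g' x + A • V₁ x‖ ^ 2) := by
  have hgg : MemLp (fun x => g x - g' x) 2 (volume.restrict (Ioc a b)) := by
    refine MemLp.mono_measure (Measure.restrict_mono Ioc_subset_Icc_self le_rfl) ?_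
    obtain ⟨C, hC⟩ := isCompact_Icc.exists_bound_of_continuousOn (hgc.sub hgc')
    refine MemLp.of_bound ((hgc.sub hgc').aestronglyMeasurable measurableSet_Icc) C ?_
    exact (ae_restrict_iff' measurableSet_Icc).2 (Eventually.of_forall hC)
  refine L.eNormV_energy_le hε hA hβ hβ1 (by linarith) hab hE hm (e := fun x => u x - w x)
    (huc.sub hwc) (hgg.add (hV₁.const_smul A)) (fun s hs t ht hst h => ?_) hinit
  have hm0 : (0 : ℝ) ≤ m := m.cast_nonneg
  have hsub : uIcc s t ⊆ Icc a b := uIcc_subset_Icc hs ht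
  have hco : ∀ {q : ℝ → H} (z : H), ContinuousOn q (Icc a b) →
      ContinuousOn (fun x => inner ℝ (q x) z) (Icc a b) := fun z hq => hq.inner continuousOn_const
  have hii : ∀ {q : ℝ → ℝ}, ContinuousOn q (Icc a b) → IntervalIntegrable q volume a b := fun hq =>
    ContinuousOn.intervalIntegrable (by rwa [uIcc_of_le hab])
  have hV₁i : IntervalIntegrable V₁ volume s t := by
    have : IntervalIntegrable V₁ volume a b := by
      rw [intervalIntegrable_iff_integrableOn_Ioc_of_le hab]
      exact hV₁.integrable (by norm_num)
    exact this.mono_set (by rwa [uIcc_of_le hab])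
  have hcu : ContinuousOn (fun x => inner ℝ (g x) (L.invPow (m - β / 2) h)
      - ε * inner ℝ (u x) (L.invPow (m - 1) h)) (Icc a b) :=
    (hco _ hgc).sub (continuousOn_const.mul (hco _ huc))
  have hcw : ContinuousOn (fun x => inner ℝ (g' x) (L.invPow (m - β / 2) h)
      - ε * inner ℝ (w x) (L.invPow (m - 1) h)) (Icc a b) :=
    (hco _ hgc').sub (continuousOn_const.mul (hco _ hwc))
  have i1 := intervalIntegral_eq_sub_of_hasDerivWithinAt (fun x hx => hu x hx h) (hii hcu) hs ht hst
  have i2 := intervalIntegral_eq_sub_of_hasDerivWithinAt (fun x hx => hw x hx h) (hii hcw) hs ht hst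
  -- The increment of `A L^p u` must be added to the equation of `u` to match that of `w`. Since
  -- `L^{-(m-p)} u = L^{-(m-β/2)} V₀`, it is an integral of `V₁`, of the same form as the source
  -- `L^{β/2} ρ`.
  have i3 : ∫ x in s..t, A * inner ℝ (V₁ x) (L.invPow (m - β / 2) h)
      = A * (inner ℝ (u t) (L.invPow (m - p) h) - inner ℝ (u s) (L.invPow (m - p) h)) := by
    have h1 := (innerSL ℝ (L.invPow (m - β / 2) h)).intervalIntegral_comp_comm hV₁i
    simp only [innerSL_apply_apply] at h1
    have h2 : ∀ x ∈ Icc a b, inner ℝ (u x) (L.invPow (m - p) h)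
        = inner ℝ (L.invPow (m - β / 2) h) (V₀ x) := fun x hx => by
      rw [huV x hx, L.invPow_symm (by linarith), L.invPow_invPow (by linarith) (by linarith)
        (q := m - β / 2) (by ring), real_inner_comm]
    rw [intervalIntegral.integral_const_mul, h2 t ht, h2 s hs, ← inner_sub_right, hV s hs t ht, ← h1]
    simp only [real_inner_comm]
  have hB : ∀ x, inner ℝ ((L.invPow m + A • L.invPow (m - p)) x) h
      = inner ℝ x (L.invPow m h) + A * inner ℝ x (L.invPow (m - p) h) := fun x => by
    have : (L.invPow m + A • L.invPow (m - p)) x = L.invPow m x + A • L.invPow (m - p) x := rfl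
    rw [this, inner_add_left, real_inner_smul_left, L.invPow_symm hm0, L.invPow_symm (by linarith)]
  have hsplit : ∫ x in s..t, inner ℝ (L.invPow (m - β / 2) (g x - g' x + A • V₁ x)
        - ε • L.invPow (m - 1) (u x - w x)) h
      = (∫ x in s..t, (inner ℝ (g x) (L.invPow (m - β / 2) h)
          - ε * inner ℝ (u x) (L.invPow (m - 1) h)))
        - (∫ x in s..t, (inner ℝ (g' x) (L.invPow (m - β / 2) h)
          - ε * inner ℝ (w x) (L.invPow (m - 1) h)))
        + ∫ x in s..t, A * inner ℝ (V₁ x) (L.invPow (m - β / 2) h) := by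
    have hu' := (hcu.mono hsub).intervalIntegrable (μ := volume)
    have hw' := (hcw.mono hsub).intervalIntegrable (μ := volume)
    rw [← intervalIntegral.integral_sub hu' hw', ← intervalIntegral.integral_add (hu'.sub hw')
      ((IntervalIntegrable.inner_const hV₁i _).const_mul A)]
    refine intervalIntegral.integral_congr fun x _ => ?_
    simp only [inner_sub_left, real_inner_smul_left]
    rw [L.invPow_symm (by linarith), L.invPow_symm (by linarith)]
    simp only [inner_add_left, inner_sub_left, real_inner_smul_left]
    ring
  change inner ℝ ((L.invPow m + A • L.invPow (m - p)) (u t - w t)) h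
    - inner ℝ ((L.invPow m + A • L.invPow (m - p)) (u s - w s)) h = _
  rw [hB, hB]
  refine Eq.trans ?_ hsplit.symm
  rw [i1, i2, i3]
  simp only [inner_sub_left]
  ring

/-- The embedding `V^q ⊆ V^γ`, whose constant is the norm of `L^{-(q-γ)/2}`; it feeds the energy
bound into the Lipschitz condition on `F`. -/
theorem norm_sub_le_of_eNormV_le {γ q D : ℝ} (hγ : 0 ≤ γ) (hq : γ ≤ q) (hD : 0 ≤ D) {v w : L.V γ}
    (h : L.eNormV q (L.toH v - L.toH w) ^ 2 ≤ ENNReal.ofReal D) :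
    ‖v - w‖ ≤ ‖L.invPow ((q - γ) / 2)‖ * √D := by
  have hne : L.eNormV q (L.toH v - L.toH w) ≠ ⊤ := fun h0 => by
    rw [h0] at h
    exact (h.trans_lt ENNReal.ofReal_lt_top).ne (by simp)
  obtain ⟨g, hg⟩ := L.exists_of_eNormV_ne_top (hγ.trans hq) hne
  rw [hg, L.eNormV_invPow (hγ.trans hq), ← ofReal_norm, ← ENNReal.ofReal_pow (norm_nonneg _),
    ENNReal.ofReal_le_ofReal_iff hD] at h
  have h1 : L.powV γ (v - w) = L.invPow ((q - γ) / 2) g := by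
    apply L.invPow_injective (s := γ / 2) (by linarith)
    rw [L.invPow_powV hγ, map_sub, hg, L.invPow_invPow (by linarith) (by linarith) (q := q / 2) (by ring)]
  rw [← L.norm_powV, h1]
  refine (ContinuousLinearMap.le_opNorm _ _).trans ?_
  gcongr
  exact Real.le_sqrt_of_sq_le h

end PosDefOp

/-! ### Integral inequalities and a discrete Gronwall lemma -/

theorem sq_intervalIntegral_le {a b : ℝ} (hab : a ≤ b) {f : ℝ → ℝ}
    (hf : IntervalIntegrable f volume a b) (hf2 : IntervalIntegrable (fun x => f x ^ 2) volume a b) :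
    (∫ x in a..b, f x) ^ 2 ≤ (b - a) * ∫ x in a..b, f x ^ 2 := by
  rcases hab.eq_or_lt with rfl | hlt
  · simp
  set I := ∫ x in a..b, f x
  -- Cauchy–Schwarz from the nonnegativity of a variance.
  have h1 : 0 ≤ ∫ x in a..b, ((b - a) * f x - I) ^ 2 :=
    intervalIntegral.integral_nonneg hab fun _ _ => sq_nonneg _
  have h2 : ∫ x in a..b, ((b - a) * f x - I) ^ 2
      = (b - a) ^ 2 * (∫ x in a..b, f x ^ 2) - 2 * (b - a) * I * I + (b - a) * I ^ 2 := by
    have : ∀ x, ((b - a) * f x - I) ^ 2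
        = (b - a) ^ 2 * f x ^ 2 - 2 * (b - a) * I * f x + I ^ 2 := fun x => by ring
    simp only [this]
    rw [intervalIntegral.integral_add ((hf2.const_mul _).sub (hf.const_mul _)) intervalIntegrable_const,
      intervalIntegral.integral_sub (hf2.const_mul _) (hf.const_mul _),
      intervalIntegral.integral_const_mul, intervalIntegral.integral_const_mul,
      intervalIntegral.integral_const, smul_eq_mul]
  have h3 : 0 ≤ (b - a) * ((b - a) * (∫ x in a..b, f x ^ 2) - I ^ 2) := by
    rw [h2] at h1; linarith
  have h4 := nonneg_of_mul_nonneg_right h3 (sub_pos.2 hlt)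
  linarith

theorem integral_norm_add_smul_sq_le {X : Type*} [NormedAddCommGroup X] [NormedSpace ℝ X]
    {a b A δ : ℝ} (hab : a ≤ b) {q V : ℝ → X} (hq : ∀ x ∈ Icc a b, ‖q x‖ ^ 2 ≤ δ)
    (hV : IntervalIntegrable (fun x => ‖V x‖ ^ 2) volume a b)
    (hqV : IntervalIntegrable (fun x => ‖q x + A • V x‖ ^ 2) volume a b) :
    ∫ x in a..b, ‖q x + A • V x‖ ^ 2
      ≤ 2 * (b - a) * δ + 2 * A ^ 2 * ∫ x in a..b, ‖V x‖ ^ 2 := by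
  have h : ∫ x in a..b, ‖q x + A • V x‖ ^ 2 ≤ ∫ x in a..b, (2 * δ + 2 * A ^ 2 * ‖V x‖ ^ 2) := by
    refine intervalIntegral.integral_mono_on hab hqV (intervalIntegrable_const.add (hV.const_mul _))
      fun x hx => ?_
    have h1 := norm_add_le (q x) (A • V x)
    have h2 : ‖A • V x‖ ^ 2 = A ^ 2 * ‖V x‖ ^ 2 := by rw [norm_smul, mul_pow, Real.norm_eq_abs, sq_abs]
    have h3 := hq x hx
    nlinarith [sq_nonneg (‖q x‖ - ‖A • V x‖), norm_nonneg (q x + A • V x)]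
  refine h.trans_eq ?_
  rw [intervalIntegral.integral_add intervalIntegrable_const (hV.const_mul _),
    intervalIntegral.integral_const, intervalIntegral.integral_const_mul, smul_eq_mul]
  ring

/-- The data terms live on overlapping windows `[t (n - K), t (n + 1)]`. Each point is covered at
most `K + 1` times, which is the factor in front of `Θ T`. -/
theorem multistep_gronwall {E : ℕ → ℝ≥0∞} {t : ℕ → ℝ} {K N : ℕ} {c σ C₀ T : ℝ} {Θ : ℝ → ℝ}
    (hc : 0 ≤ c) (hσ : 0 ≤ σ) (hC₀ : 0 ≤ C₀) (ht0 : t 0 = 0) (ht : ∀ n < N, t n < t (n + 1))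
    (hΘ0 : ∀ x ∈ Icc 0 T, 0 ≤ Θ x) (hΘ : MonotoneOn Θ (Icc 0 T))
    (hinit : ∀ j ≤ K, j ≤ N → t j ≤ T → E j ≤ ENNReal.ofReal (C₀ * σ))
    (hstep : ∀ n, K ≤ n → n < N → t (n + 1) ≤ T → ∀ D, 0 ≤ D →
      (∀ j ≤ n, E j ≤ ENNReal.ofReal D) →
      E (n + 1) ≤ ENNReal.ofReal (D + c * (t (n + 1) - t n) * D
        + c * σ * (Θ (t (n + 1)) - Θ (t (n - K)))))
    {n : ℕ} (hn : n ≤ N) (hnT : t n ≤ T) :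
    E n ≤ ENNReal.ofReal (Real.exp (c * T) * (C₀ + c * ((K + 1) * Θ T)) * σ) := by
  have hmem : ∀ {i j : ℕ}, i ≤ j → j ≤ N → t j ≤ T → t i ∈ Icc 0 T := fun hij hj hjT =>
    ⟨ht0 ▸ node_le ht (Nat.zero_le _) (hij.trans hj), (node_le ht hij hj).trans hjT⟩
  have hT0 : 0 ≤ T := (hmem le_rfl hn hnT).1.trans hnT
  have hTm : T ∈ Icc 0 T := ⟨hT0, le_rfl⟩
  -- Chosen so that `S (n + 1) - S n` is exactly the window increment `Θ (t (n + 1)) - Θ (t (n -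
  -- K))`, valid for `n ≥ K`; the majorant `B` can then be propagated by one exponential inequality.
  set S : ℕ → ℝ := fun n => ∑ l ∈ Finset.range (K + 1), Θ (t (n - l))
  set B : ℕ → ℝ := fun n => Real.exp (c * t n) * (C₀ + c * S n) * σ with hB
  have hS0 : ∀ n ≤ N, t n ≤ T → 0 ≤ S n := fun n hn hnT =>
    Finset.sum_nonneg fun l _ => hΘ0 _ (hmem (Nat.sub_le _ _) hn hnT)
  have hBinit : ∀ n ≤ N, t n ≤ T → C₀ * σ ≤ B n := by
    intro n hn hnT
    have h1 : 1 ≤ Real.exp (c * t n) := Real.one_le_exp (mul_nonneg hc (hmem le_rfl hn hnT).1)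
    have h2 : C₀ ≤ C₀ + c * S n := le_add_of_nonneg_right (mul_nonneg hc (hS0 n hn hnT))
    simp only [hB]
    gcongr
    nlinarith
  have hBfin : ∀ n ≤ N, t n ≤ T → B n ≤ Real.exp (c * T) * (C₀ + c * ((K + 1) * Θ T)) * σ := by
    intro n hn hnT
    have h1 : S n ≤ (K + 1) * Θ T := by
      refine (Finset.sum_le_sum (g := fun _ => Θ T) fun l _ => ?_).trans_eq (by simp)
      exact hΘ (hmem (Nat.sub_le _ _) hn hnT) hTm (hmem (Nat.sub_le _ _) hn hnT).2
    have h2 : 0 ≤ C₀ + c * S n := by have := hS0 n hn hnT; positivity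
    simp only [hB]
    gcongr
  have key : ∀ n, K ≤ n → n ≤ N → t n ≤ T → ∀ j ≤ n, E j ≤ ENNReal.ofReal (B n) := by
    intro n hKn
    induction n, hKn using Nat.le_induction with
    | base =>
      intro hN hT j hj
      exact (hinit j hj (hj.trans hN) (hmem hj hN hT).2).trans
        (ENNReal.ofReal_le_ofReal (hBinit K hN hT))
    | succ n hKn ih =>
      intro hN hT j hj
      have hnT : t n ≤ T := (hmem n.le_succ hN hT).2
      have hnN : n ≤ N := by omega
      have ih' := ih hnN hnT
      have hB0 : 0 ≤ B n := (mul_nonneg hC₀ hσ).trans (hBinit n hnN hnT)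
      set Δ := Θ (t (n + 1)) - Θ (t (n - K)) with hΔ
      have hΔ0 : 0 ≤ Δ := sub_nonneg.2
        (hΘ (hmem (by omega) hN hT) (hmem le_rfl hN hT) (node_le ht (by omega) hN))
      have hSS : S (n + 1) = S n + Δ := by
        simp only [S]
        rw [Finset.sum_range_succ', Finset.sum_range_succ (fun l => Θ (t (n - l)))]
        simp only [Nat.add_sub_add_right, Nat.sub_zero, hΔ]
        ring
      have hτ : 0 ≤ t (n + 1) - t n := sub_nonneg.2 (ht n hN).le
      have hexp : Real.exp (c * t n) * (1 + c * (t (n + 1) - t n)) ≤ Real.exp (c * t (n + 1)) := by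
        rw [show c * t (n + 1) = c * t n + c * (t (n + 1) - t n) by ring, Real.exp_add]
        gcongr
        linarith [Real.add_one_le_exp (c * (t (n + 1) - t n))]
      have hexp1 : 1 ≤ Real.exp (c * t (n + 1)) :=
        Real.one_le_exp (mul_nonneg hc (hmem le_rfl hN hT).1)
      have hstepB : B n + c * (t (n + 1) - t n) * B n + c * σ * Δ ≤ B (n + 1) := by
        have hP : 0 ≤ (C₀ + c * S n) * σ := by have := hS0 n hnN hnT; positivity
        have h1 := mul_le_mul_of_nonneg_right hexp hP
        have h2 := mul_le_mul_of_nonneg_right hexp1 (mul_nonneg (mul_nonneg hc hσ) hΔ0)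
        simp only [hB, hSS]
        linarith
      rcases Nat.of_le_succ hj with hj | rfl
      · refine (ih' j hj).trans (ENNReal.ofReal_le_ofReal (le_trans ?_ hstepB))
        have h1 : 0 ≤ c * (t (n + 1) - t n) * B n := by positivity
        have h2 : 0 ≤ c * σ * Δ := by positivity
        linarith
      · exact (hstep n hKn hN hT (B n) hB0 ih').trans (ENNReal.ofReal_le_ofReal hstepB)
  rcases le_total K n with h | h
  · exact (key n h hn hnT n le_rfl).trans (ENNReal.ofReal_le_ofReal (hBfin n hn hnT))
  · exact (hinit n h hn hnT).trans
      (ENNReal.ofReal_le_ofReal ((hBinit n hn hnT).trans (hBfin n hn hnT)))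

/-- The error of extrapolation from perturbed values. -/
theorem norm_sub_lagrange_perturbed_sq_le {X : Type*} [NormedAddCommGroup X] [NormedSpace ℝ X]
    [CompleteSpace X] {t : ℕ → ℝ} {N k n : ℕ} {r τ δ J : ℝ}
    (ht : ∀ n < N, t n < t (n + 1)) (hr0 : 0 ≤ r)
    (hr : ∀ n < N, ∀ m < N, |(n : ℤ) - m| < (k + 1 : ℕ) → stepSize t n / stepSize t m ≤ r)
    (hτ : ∀ n < N, stepSize t n ≤ τ) (hn : n < N) (hk : k ≤ n) {h : ℕ → ℝ → X}
    (hi : ∀ j ≤ k + 1, IntervalIntegrable (h j) volume (t (n - k)) (t (n + 1)))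
    (hi2 : IntervalIntegrable (fun x => ‖h (k + 1) x‖ ^ 2) volume (t (n - k)) (t (n + 1)))
    (hh : ∀ j ≤ k, ∀ x ∈ Icc (t (n - k)) (t (n + 1)),
      h j x - h j (t (n - k)) = ∫ y in t (n - k)..x, h (j + 1) y)
    (hJ : ∫ y in t (n - k)..t (n + 1), ‖h (k + 1) y‖ ^ 2 ≤ J)
    {z : ℕ → X} (hz : ∀ i ≤ k, ‖h 0 (t (n - i)) - z i‖ ≤ δ)
    {s : ℝ} (hs : s ∈ Icc (t n) (t (n + 1))) :
    ‖h 0 s - ∑ i ∈ Finset.range (k + 1), lagrangeBasis t (k + 1) n i (s - t n) • z i‖ ^ 2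
      ≤ 2 * ((1 + (k + 1) * ((k + 1 : ℕ) * r) ^ k) ^ 2 * (((k + 1) * τ) ^ (2 * k + 1) * J))
        + 2 * ((k + 1) * ((k + 1 : ℕ) * r) ^ k * δ) ^ 2 := by
  set Λ : ℝ := ((k + 1 : ℕ) * r) ^ k
  have hab : t (n - k) ≤ t (n + 1) := node_le ht (by omega) hn
  set b := t (n + 1) - t (n - k)
  have hb0 : 0 ≤ b := sub_nonneg.2 hab
  have hb : b ≤ (k + 1) * τ := node_sub_le hk fun l _ => hτ _ (by omega)
  set I := ∫ y in t (n - k)..t (n + 1), ‖h (k + 1) y‖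
  have hI0 : 0 ≤ I := intervalIntegral.integral_nonneg hab fun _ _ => norm_nonneg _
  -- Cauchy–Schwarz over the window yields one more factor `b`, hence the exponent `2 * k + 1`.
  have hI2 : I ^ 2 ≤ b * J :=
    (sq_intervalIntegral_le hab (hi _ le_rfl).norm hi2).trans (by gcongr)
  have hJ0 : 0 ≤ J := (intervalIntegral.integral_nonneg hab fun _ _ => sq_nonneg _).trans hJ
  have h1 := norm_sub_lagrange_le ht hr0 hr hn hk hi hh hs
  have h2 : ‖∑ i ∈ Finset.range (k + 1), lagrangeBasis t (k + 1) n i (s - t n) •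
      (h 0 (t (n - i)) - z i)‖ ≤ (k + 1) * Λ * δ := by
    refine (norm_sum_le_of_le (n := fun _ => Λ * δ) _ fun i hi => ?_).trans_eq ?_
    · have hik := Finset.mem_range.1 hi
      rw [norm_smul, Real.norm_eq_abs]
      exact mul_le_mul (abs_lagrangeBasis_le ht hr hn (by omega) hik hs) (hz i (by omega))
        (norm_nonneg _) (by positivity)
    · rw [Finset.sum_const, Finset.card_range, nsmul_eq_mul]; push_cast; ring
  have h3 : h 0 s - ∑ i ∈ Finset.range (k + 1), lagrangeBasis t (k + 1) n i (s - t n) • z i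
      = (h 0 s - ∑ i ∈ Finset.range (k + 1), lagrangeBasis t (k + 1) n i (s - t n) • h 0 (t (n - i)))
        + ∑ i ∈ Finset.range (k + 1), lagrangeBasis t (k + 1) n i (s - t n) •
          (h 0 (t (n - i)) - z i) := by
    simp only [smul_sub, Finset.sum_sub_distrib]
    abel
  rw [h3]
  set x := h 0 s - ∑ i ∈ Finset.range (k + 1), lagrangeBasis t (k + 1) n i (s - t n) • h 0 (t (n - i))
  set y := ∑ i ∈ Finset.range (k + 1), lagrangeBasis t (k + 1) n i (s - t n) • (h 0 (t (n - i)) - z i)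
  have h4 : ‖x + y‖ ^ 2 ≤ 2 * ‖x‖ ^ 2 + 2 * ‖y‖ ^ 2 := by
    have := norm_add_le x y
    nlinarith [sq_nonneg (‖x‖ - ‖y‖), norm_nonneg (x + y)]
  have h5 : ‖x‖ ^ 2 ≤ (1 + (k + 1) * Λ) ^ 2 * (((k + 1) * τ) ^ (2 * k + 1) * J) := by
    calc ‖x‖ ^ 2 ≤ ((1 + (k + 1) * Λ) * (b ^ k * I)) ^ 2 := by gcongr
      _ = (1 + (k + 1) * Λ) ^ 2 * (b ^ (2 * k) * I ^ 2) := by ring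
      _ ≤ (1 + (k + 1) * Λ) ^ 2 * (b ^ (2 * k) * (b * J)) := by gcongr
      _ = (1 + (k + 1) * Λ) ^ 2 * (b ^ (2 * k + 1) * J) := by ring
      _ ≤ _ := by gcongr
  have h6 : ‖y‖ ^ 2 ≤ ((k + 1) * Λ * δ) ^ 2 := by gcongr
  linarith

/-! ### The convergence theorem. -/

theorem mainTheorem2 {H : Type*} [NormedAddCommGroup H] [InnerProductSpace ℝ H] [CompleteSpace H]
    (L : PosDefOp H) (ε T A β γ p CL C₀ r : ℝ) (k : ℕ)
    (hε : 0 < ε) (hT : 0 < T) (hA : 0 ≤ A) (hk : 1 ≤ k)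
    (hβ : 0 ≤ β) (hγ : 0 ≤ γ) (hβγ : β + γ ≤ 1) (hp : β + γ ≤ 2 * p)
    (F : L.V γ → L.VDual β) (hF : ∀ v w : L.V γ, ‖F v - F w‖ ≤ CL * ‖v - w‖)
    (u : ℝ → L.V γ) (hu : L.IsSolution ε T F u)
    (hFu : MemSobolev k T fun s => F (u s))
    (hureg : ∃ v : ℝ → L.V (2 * p - β),
      (∀ s ∈ Icc 0 T, L.toH (v s) = L.toH (u s)) ∧ MemSobolev 1 T v) :
    ∃ C : ℝ, 0 < C ∧
      ∀ (N : ℕ) (t : ℕ → ℝ) (τ : ℝ) (U : ℕ → L.V γ),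
        t 0 = 0 → (∀ n < N, t n < t (n + 1)) →
        IsGreatest (stepSize t '' Iio N) τ → τ < 1 →
        (∀ n < N, ∀ m < N, |(n : ℤ) - m| < k → stepSize t n / stepSize t m ≤ r) →
        (∀ n < N, k ≤ n + 1 → L.IsETDStep ε A p τ k F t U n) →
        (∀ j < k, j ≤ N → t j ≤ T →
          L.eNormV (1 - β) (L.toH (u (t j)) - L.toH (U j)) ^ 2
            + ENNReal.ofReal (A * τ ^ k)
              * L.eNormV (p + (1 - β)) (L.toH (u (t j)) - L.toH (U j)) ^ 2
            ≤ ENNReal.ofReal (C₀ * τ ^ (2 * k))) →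
        ∀ n ≤ N, t n ≤ T →
          L.eNormV (1 - β) (L.toH (u (t n)) - L.toH (U n)) ^ 2
            + ENNReal.ofReal (A * τ ^ k)
              * L.eNormV (p + (1 - β)) (L.toH (u (t n)) - L.toH (U n)) ^ 2
            ≤ ENNReal.ofReal (C * τ ^ (2 * k)) := by
  obtain ⟨K, rfl⟩ : ∃ K, k = K + 1 := ⟨k - 1, by omega⟩
  have hp0 : 0 ≤ p := by linarith
  have hpβ : β / 2 ≤ p := by linarith
  have hβ1 : β ≤ 1 := by linarith
  obtain ⟨v, hv, hvS⟩ := hureg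
  obtain ⟨V₀, V₁, hV₁, hV₁i, hV, huV⟩ := hu.exists_primitive hT hβ (by linarith) hv hvS
  obtain ⟨h, hh0, hhL, hhi, hhp⟩ := MemSobolev.exists_primitive hT (hFu.map (L.rep hβ))
  have huc : ContinuousOn (fun t => L.toH (u t)) (Icc 0 T) :=
    ((L.invPow (p - β / 2)).continuous.comp_continuousOn
      (continuousOn_of_sub_eq_integral hT.le hV₁i hV)).congr huV
  have hhc : ContinuousOn (h 0) (Icc 0 T) :=
    continuousOn_of_sub_eq_integral hT.le (hhi 1 (by omega)) (hhp 0 (by omega))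
  -- Needed at every time: the scheme samples `F(u)` at nodes, which a.e. equality does not see.
  have hG := hu.rep_eq hT hβ huc hhc hh0
  have hsq : ∀ {f : ℝ → H}, MemLp f 2 (volume.restrict (Ioo 0 T)) →
      IntervalIntegrable (fun x => ‖f x‖ ^ 2) volume 0 T := fun hf => by
    rw [intervalIntegrable_iff_integrableOn_Ioo_of_le hT.le]
    exact hf.integrable_norm_pow (by norm_num)
  have hhsq := hsq hhL
  have hVsq := hsq hV₁
  have hθi := hhsq.add hVsq
  -- Cumulative mass of the two quantities that drive the consistency error. Its window increments
  -- bound both integrals of a step.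
  set Θ : ℝ → ℝ := fun x => ∫ y in 0..x, (‖h (K + 1) y‖ ^ 2 + ‖V₁ y‖ ^ 2) with hΘdef
  have hsub : ∀ {s t : ℝ}, s ∈ Icc 0 T → t ∈ Icc 0 T → uIcc s t ⊆ uIcc 0 T := fun hs ht => by
    rw [uIcc_of_le hT.le]
    exact uIcc_subset_Icc hs ht
  have h0T : (0 : ℝ) ∈ Icc 0 T := ⟨le_rfl, hT.le⟩
  have hTT : T ∈ Icc 0 T := ⟨hT.le, le_rfl⟩
  have hΘsub : ∀ s ∈ Icc 0 T, ∀ t ∈ Icc 0 T,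
      Θ t - Θ s = ∫ y in s..t, (‖h (K + 1) y‖ ^ 2 + ‖V₁ y‖ ^ 2) := fun s hs t ht =>
    intervalIntegral.integral_interval_sub_left (hθi.mono_set (hsub h0T ht))
      (hθi.mono_set (hsub h0T hs))
  have hΘ0 : ∀ x ∈ Icc 0 T, 0 ≤ Θ x := fun x hx =>
    intervalIntegral.integral_nonneg hx.1 fun _ _ => by positivity
  have hΘm : MonotoneOn Θ (Icc 0 T) := fun s hs t ht hst => by
    rw [← sub_nonneg, hΘsub s hs t ht]
    exact intervalIntegral.integral_nonneg hst fun _ _ => by positivity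
  obtain ⟨m, hm⟩ := exists_nat_ge (p + 2)
  set r' := max r 0
  set Λ : ℝ := ((K + 1 : ℕ) * r') ^ K with hΛ
  -- Embedding constant of `V^{1-β} ⊆ V^γ`. Below, `a₁` measures the interpolation error and `a₂`
  -- the propagation of old errors through `F`.
  set κ : ℝ := ‖L.invPow (((1 - β) - γ) / 2)‖
  set a₁ : ℝ := (1 + (K + 1) * Λ) ^ 2 * (K + 1) ^ (2 * K + 1) with ha₁
  set a₂ : ℝ := ((K + 1) * Λ * (|CL| * κ)) ^ 2 with ha₂
  -- The prefactor `(2ε)⁻¹` is that of the energy estimate. The inequality `(x + y)² ≤ 2x² + 2y²` is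
  -- used twice for `a₁` and `a₂` and once for the stabilization term.
  set c : ℝ := (2 * ε)⁻¹ * (4 * a₁ + 4 * a₂ + 2 * A ^ 2) with hcdef
  have ha₁0 : 0 ≤ a₁ := by positivity
  have ha₂0 : 0 ≤ a₂ := by positivity
  have hc0 : 0 ≤ c := by positivity
  -- The summand `1` secures positivity; `max C₀ 0` allows a negative `C₀`.
  refine ⟨Real.exp (c * T) * (max C₀ 0 + c * ((K + 1) * Θ T)) + 1, ?_, ?_⟩
  · have := hΘ0 T hTT
    positivity
  intro N t τ U ht0 ht hτ hτ1 hr hETD hinit n hn hnT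
  have hτle : ∀ n < N, stepSize t n ≤ τ := fun n hn => hτ.2 ⟨n, hn, rfl⟩
  have hτ0 : 0 < τ := by
    obtain ⟨i, hi, hiτ⟩ := hτ.1
    rw [← hiτ]
    exact sub_pos.2 (ht i hi)
  have hr' : ∀ n < N, ∀ m < N, |(n : ℤ) - m| < (K + 1 : ℕ) → stepSize t n / stepSize t m ≤ r' :=
    fun n hn m hm h => (hr n hn m hm h).trans (le_max_left _ _)
  have hr0 : 0 ≤ r' := le_max_right _ _
  set σ := τ ^ (2 * (K + 1)) with hσ
  have hσ0 : 0 ≤ σ := by positivity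
  have hA' : 0 ≤ A * τ ^ (K + 1) := by positivity
  refine le_trans (multistep_gronwall (c := c) (σ := σ) (C₀ := max C₀ 0) (T := T) (K := K)
    (E := fun j => L.eNormV (1 - β) (L.toH (u (t j)) - L.toH (U j)) ^ 2
      + ENNReal.ofReal (A * τ ^ (K + 1))
        * L.eNormV (p + (1 - β)) (L.toH (u (t j)) - L.toH (U j)) ^ 2)
    hc0 hσ0 (le_max_right _ _) ht0 ht hΘ0 hΘm ?_ ?_ hn hnT) ?_
  · intro j hj hjN hjT
    refine (hinit j (by omega) hjN hjT).trans (ENNReal.ofReal_le_ofReal ?_)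
    gcongr
    exact le_max_left _ _
  · intro n hKn hnN hnT D hD hE
    have hmem : ∀ {i : ℕ}, i ≤ n + 1 → t i ∈ Icc 0 T := fun hi =>
      ⟨ht0 ▸ node_le ht (Nat.zero_le _) (by omega), (node_le ht hi (by omega)).trans hnT⟩
    have hab : t n ≤ t (n + 1) := (ht n hnN).le
    have hIcc : Icc (t n) (t (n + 1)) ⊆ Icc 0 T := Icc_subset_Icc (hmem n.le_succ).1 hnT
    have hIcc' : Icc (t (n - K)) (t (n + 1)) ⊆ Icc 0 T :=
      Icc_subset_Icc (hmem (i := n - K) (by omega)).1 hnT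
    have hm1 : (1 : ℝ) ≤ m := by linarith
    obtain ⟨w, hwc, hw0, hw1, hw⟩ := (hETD n hnN (by omega)).exists_hasDerivWithinAt hβ
      (m := m) (by linarith) hm1 hp0 (by linarith)
    set g' : ℝ → H := fun s => ∑ i ∈ Finset.range (K + 1),
      lagrangeBasis t (K + 1) n i (s - t n) • L.rep hβ (F (U (n - i))) with hg'
    have hgc' : Continuous g' := continuous_finsetSum _ fun i _ =>
      ((continuous_lagrangeBasis t (K + 1) n i).comp (continuous_sub_right _)).smul continuous_const
    have hV₁' : MemLp V₁ 2 (volume.restrict (Ioc (t n) (t (n + 1)))) := by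
      rw [restrict_Ioo_eq_restrict_Ioc] at hV₁
      exact hV₁.mono_measure (Measure.restrict_mono
        (Ioc_subset_Ioc (hmem n.le_succ).1 hnT) le_rfl)
    have hstep := L.eNormV_sub_le hε hA' hβ hβ1 hpβ hab hD hm (u := fun t => L.toH (u t))
      (g := h 0) (V₀ := V₀) (V₁ := V₁) (w := w) (g' := g') (huc.mono hIcc) (hhc.mono hIcc)
      (fun x hx z => by
        have := (hu.hasDerivWithinAt hβ (m := m) (by linarith) hm1 (hIcc hx) z).mono hIcc
        rwa [hG x (hIcc hx)] at this)
      (fun x hx => huV x (hIcc hx)) (fun s hs t ht => hV s (hIcc hs) t (hIcc ht)) hV₁' hwc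
      hgc'.continuousOn hw (by rw [hw0]; exact hE n le_rfl)
    simp only [hw1] at hstep
    refine hstep.trans (ENNReal.ofReal_le_ofReal ?_)
    set J := Θ (t (n + 1)) - Θ (t (n - K)) with hJ
    have hnK : t (n - K) ∈ Icc 0 T := hmem (by omega)
    have hn1 : t (n + 1) ∈ Icc 0 T := hmem le_rfl
    have hnn : t n ∈ Icc 0 T := hmem n.le_succ
    have hKn1 : t (n - K) ≤ t (n + 1) := node_le ht (by omega) hnN
    have hJh : ∫ y in t (n - K)..t (n + 1), ‖h (K + 1) y‖ ^ 2 ≤ J := by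
      rw [hJ, hΘsub _ hnK _ hn1]
      refine intervalIntegral.integral_mono_on hKn1 (hhsq.mono_set (hsub hnK hn1))
        (hθi.mono_set (hsub hnK hn1)) fun x _ => ?_
      exact le_add_of_nonneg_right (by positivity)
    have hJV : ∫ y in t n..t (n + 1), ‖V₁ y‖ ^ 2 ≤ J := by
      have h1 : Θ (t (n - K)) ≤ Θ (t n) := hΘm hnK hnn (node_le ht (by omega) hnN.le)
      refine le_trans ?_ (sub_le_sub_left h1 _)
      rw [hΘsub _ hnn _ hn1]
      refine intervalIntegral.integral_mono_on hab (hVsq.mono_set (hsub hnn hn1))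
        (hθi.mono_set (hsub hnn hn1)) fun x _ => ?_
      exact le_add_of_nonneg_left (by positivity)
    have hJ0 : 0 ≤ J := (intervalIntegral.integral_nonneg hab fun _ _ => sq_nonneg _).trans hJV
    have hz : ∀ i ≤ K, ‖h 0 (t (n - i)) - L.rep hβ (F (U (n - i)))‖ ≤ |CL| * (κ * √D) := by
      intro i hi
      rw [← hG _ (hmem (by omega)), ← map_sub]
      have h1 : ‖u (t (n - i)) - U (n - i)‖ ≤ κ * √D :=
        L.norm_sub_le_of_eNormV_le hγ (by linarith) hD
          (le_self_add.trans (hE (n - i) (by omega)))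
      calc _ ≤ CL * ‖u (t (n - i)) - U (n - i)‖ := (L.norm_rep_le hβ _).trans (hF _ _)
        _ ≤ |CL| * (κ * √D) := by
          gcongr
          exact le_abs_self _
    have hcons := fun s hs => norm_sub_lagrange_perturbed_sq_le ht hr0 hr' hτle hnN hKn
      (h := h) (fun j hj => (hhi j hj).mono_set (hsub hnK hn1)) (hhsq.mono_set (hsub hnK hn1))
      (fun j hj x hx => hhp j (by omega) _ hnK x (hIcc' hx)) hJh
      (z := fun i => L.rep hβ (F (U (n - i)))) hz (s := s) hs
    have hρ : MemLp (fun x => h 0 x - g' x + (A * τ ^ (K + 1)) • V₁ x) 2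
        (volume.restrict (Ioc (t n) (t (n + 1)))) := by
      refine MemLp.add ?_ (hV₁'.const_smul _)
      refine MemLp.mono_measure (Measure.restrict_mono Ioc_subset_Icc_self le_rfl) ?_
      have hcont := (hhc.mono hIcc).sub hgc'.continuousOn
      obtain ⟨C, hC⟩ := isCompact_Icc.exists_bound_of_continuousOn hcont
      exact MemLp.of_bound (hcont.aestronglyMeasurable measurableSet_Icc) C
        ((ae_restrict_iff' measurableSet_Icc).2 (Eventually.of_forall hC))
    have hint := integral_norm_add_smul_sq_le (A := A * τ ^ (K + 1)) (q := fun x => h 0 x - g' x)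
      hab hcons (hVsq.mono_set (hsub hnn hn1)) (by
        rw [intervalIntegrable_iff_integrableOn_Ioc_of_le hab]
        exact hρ.integrable_norm_pow (by norm_num))
    have hτn : t (n + 1) - t n ≤ τ := hτle n hnN
    have hτn0 : 0 ≤ t (n + 1) - t n := sub_nonneg.2 hab
    have e1 : (1 + ((K : ℝ) + 1) * Λ) ^ 2 * (((K + 1) * τ) ^ (2 * K + 1) * J)
        = a₁ * (τ ^ (2 * K + 1) * J) := by
      rw [ha₁, mul_pow]; ring
    have e2 : ((K + 1) * Λ * (|CL| * (κ * √D))) ^ 2 = a₂ * D := by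
      rw [ha₂, show (K + 1) * Λ * (|CL| * (κ * √D)) = (K + 1) * Λ * (|CL| * κ) * √D by ring,
        mul_pow, Real.sq_sqrt hD]
    have e3 : (A * τ ^ (K + 1)) ^ 2 = A ^ 2 * σ := by rw [hσ]; ring
    -- The length of the step supplies the last factor `τ`, raising `τ^(2K+1)` to `σ = τ^(2k)` with
    -- `k = K + 1`.
    have e4 : (t (n + 1) - t n) * (a₁ * (τ ^ (2 * K + 1) * J)) ≤ a₁ * (σ * J) := by
      calc _ ≤ τ * (a₁ * (τ ^ (2 * K + 1) * J)) := by gcongr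
        _ = a₁ * (σ * J) := by rw [hσ]; ring
    have e5 : A ^ 2 * σ * ∫ y in t n..t (n + 1), ‖V₁ y‖ ^ 2 ≤ A ^ 2 * σ * J := by gcongr
    rw [← hΛ, e1, e2, e3] at hint
    have hfin : ∫ x in t n..t (n + 1), ‖h 0 x - g' x + (A * τ ^ (K + 1)) • V₁ x‖ ^ 2
        ≤ (4 * a₁ + 4 * a₂ + 2 * A ^ 2) * ((t (n + 1) - t n) * D + σ * J) := by
      have q1 : 0 ≤ a₁ * ((t (n + 1) - t n) * D) := by positivity
      have q2 : 0 ≤ a₂ * (σ * J) := by positivity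
      have q3 : 0 ≤ A ^ 2 * ((t (n + 1) - t n) * D) := by positivity
      linarith
    have hfin' := mul_le_mul_of_nonneg_left hfin (inv_nonneg.2 (mul_pos two_pos hε).le)
    rw [← mul_assoc, ← hcdef] at hfin'
    linarith
  · refine ENNReal.ofReal_le_ofReal ?_
    gcongr
    linarith
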